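/- Let $f$ be a holomorphic function in a neighbourhood of $0\in\mathbb{C}^3$ with Taylor expansion $\sum_{\nu\in\mathbb{N}^3}a_\nu z^\nu$ at $0$, and suppose that $f$ is an isolated singularity: $f\not\equiv 0$ near $0$, $f(0)=0$, $\nabla f(0)=0$, and $\nabla f(z)\neq 0$ for all $z\neq 0$ close to $0$. Let $\Gamma_+(f)=\operatorname{conv}\bigcup_{a_\nu\ne 0}(\nu+\mathbb{R}_{\ge 0}^3)\subset\mathbb{R}^3$ be its Newton diagram. A face of $\Gamma_+(f)$ is a set of the form $\{v\in\Gamma_+(f):\langle u,v\rangle=\inf_{w\in\Gamma_+(f)}\langle u,w\rangle\}$ with $u\in\mathbb{R}_{\ge 0}^3\setminus\{0\}$, and $\Gamma^2(f)$ denotes the set of compact $2$-dimensional faces. A face $S\in\Gamma^2(f)$ is called exceptional with respect to the coordinate axis $OX_i$ if one of its vertices is at (Euclidean) distance $1$ from $OX_i$ and its other vertices constitute a $1$-dimensional face (an edge of $S$) lying in one of the coordinate planes containing $OX_i$. Let $E_f$ be the set of those $S\in\Gamma^2(f)$ that are exceptional with respect to some axis $OX_i$, $i\in\{1,2,3\}$;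 the elements of $\Gamma^2(f)\setminus E_f$ are called unexceptional. Assume that $\Gamma^2(f)\setminus E_f\neq\emptyset$. Then for every $i\in\{1,2,3\}$ there exists a face $S_i\in\Gamma^2(f)\setminus E_f$ for which at least one of the following two conditions holds: (i) there exists a point $W\in OX_i$ which is a vertex of $S_i$; (ii) there exist $j,k\in\{1,2,3\}\setminus\{i\}$, $j\neq k$, and vertices $W\in OX_iX_j$, at distance $1$ from the axis $OX_i$, and $Y\in OX_iX_k$ of $S_i$ such that the segment $\overline{WY}$ is an edge of $S_i$. -/

import Mathlib

open Set Topology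

noncomputable section

namespace NewtonDiagram

/-- The partial derivative `∂f/∂z_i`, as a function on `ℂⁿ`. -/
def partialDeriv {n : ℕ} (i : Fin n) (f : (Fin n → ℂ) → ℂ) : (Fin n → ℂ) → ℂ :=
  fun z => fderiv ℂ f z (Pi.single i 1)

/-- The mixed partial derivative `∂^{|ν|} f / ∂z_1^{ν_1} ⋯ ∂z_n^{ν_n}`. -/
def mixedPartialDeriv {n : ℕ} (ν : Fin n → ℕ) (f : (Fin n → ℂ) → ℂ) : (Fin n → ℂ) → ℂ :=
  (List.finRange n).foldr (fun i g => (partialDeriv i)^[ν i] g) f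

/-- The coefficient `a_ν` of the Taylor expansion `∑ a_ν z^ν` of `f` at the origin. -/
def taylorCoeff {n : ℕ} (f : (Fin n → ℂ) → ℂ) (ν : Fin n → ℕ) : ℂ :=
  mixedPartialDeriv ν f 0 / ((∏ i, (ν i).factorial : ℕ) : ℂ)

/-- `f` is a singularity: a nonzero germ at `0` of a holomorphic function
with `f(0) = 0` and `∇f(0) = 0`. -/
structure IsSingularity {n : ℕ} (f : (Fin n → ℂ) → ℂ) : Prop where
  analyticAt : AnalyticAt ℂ f 0
  nonzero : ¬ (∀ᶠ z in 𝓝 (0 : Fin n → ℂ), f z = 0)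
  map_zero : f 0 = 0
  gradient_zero : ∀ i, partialDeriv i f 0 = 0

/-- `f` is an isolated singularity: moreover `∇f(z) ≠ 0` for all `z ≠ 0` close to `0`. -/
structure IsIsolatedSingularity {n : ℕ} (f : (Fin n → ℂ) → ℂ) : Prop extends
    IsSingularity f where
  isolated : ∀ᶠ z in 𝓝[≠] (0 : Fin n → ℂ), ∃ i, partialDeriv i f z ≠ 0

/-- The Newton diagram `Γ₊(f) = conv {ν + ℝ₊ⁿ : a_ν ≠ 0}`. -/
def newtonDiagram {n : ℕ} (f : (Fin n → ℂ) → ℂ) : Set (EuclideanSpace ℝ (Fin n)) :=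
  convexHull ℝ {x | ∃ ν : Fin n → ℕ, taylorCoeff f ν ≠ 0 ∧ ∀ i, (ν i : ℝ) ≤ x i}

/-- `Δ(u, A)`: the set of points of `A` at which `⟨u, ·⟩` attains its infimum over `A`. -/
def supportSet {n : ℕ} (u : EuclideanSpace ℝ (Fin n)) (A : Set (EuclideanSpace ℝ (Fin n))) :
    Set (EuclideanSpace ℝ (Fin n)) :=
  {v | v ∈ A ∧ ∀ w ∈ A, inner ℝ u v ≤ inner ℝ u w}

/-- The Newton boundary `Γ(f)`: the family of all compact faces `Δ(u, Γ₊(f))`,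
`u ∈ ℝ₊ⁿ \ {0}`, of the Newton diagram. -/
def newtonBoundary {n : ℕ} (f : (Fin n → ℂ) → ℂ) : Set (Set (EuclideanSpace ℝ (Fin n))) :=
  {S | (∃ u : EuclideanSpace ℝ (Fin n), (∀ i, 0 ≤ u i) ∧ u ≠ 0 ∧
      S = supportSet u (newtonDiagram f)) ∧ IsCompact S}

/-- The (affine) dimension of a convex set. -/
def dim {n : ℕ} (S : Set (EuclideanSpace ℝ (Fin n))) : ℕ :=
  Module.finrank ℝ (vectorSpan ℝ S)

/-- `Γᵏ(f)`: the compact faces of dimension `k`. -/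
def newtonFaces {n : ℕ} (f : (Fin n → ℂ) → ℂ) (k : ℕ) :
    Set (Set (EuclideanSpace ℝ (Fin n))) :=
  {S | S ∈ newtonBoundary f ∧ dim S = k}

/-- The vertices of a (compact, convex) face. -/
def vertices {n : ℕ} (S : Set (EuclideanSpace ℝ (Fin n))) : Set (EuclideanSpace ℝ (Fin n)) :=
  S.extremePoints ℝ

/-- The segment joining `W` and `Y` is an edge (a one-dimensional face) of `S`. -/
def IsEdge {n : ℕ} (S : Set (EuclideanSpace ℝ (Fin n))) (W Y : EuclideanSpace ℝ (Fin n)) : Prop :=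
  W ≠ Y ∧ IsExposed ℝ S (segment ℝ W Y)

/-- The coordinate axis `OX_i`. -/
def axis {n : ℕ} (i : Fin n) : Set (EuclideanSpace ℝ (Fin n)) :=
  {x | ∀ l, l ≠ i → x l = 0}

/-- The coordinate plane `OX_iX_j`. -/
def coordPlane {n : ℕ} (i j : Fin n) : Set (EuclideanSpace ℝ (Fin n)) :=
  {x | ∀ l, l ≠ i → l ≠ j → x l = 0}

/-- The coordinate hyperplane `{x_j = 0}`. It contains the axis `OX_i` iff `j ≠ i`. -/
def coordHyperplane {n : ℕ} (j : Fin n) : Set (EuclideanSpace ℝ (Fin n)) :=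
  {x | x j = 0}

/-- `S` (a compact face of dimension `n - 1`) is exceptional with respect to the axis `OX_i`:
one of its vertices is at (Euclidean) distance `1` to `OX_i`, and the other vertices
constitute an `(n-2)`-dimensional face of `S` which lies in a coordinate hyperplane
including `OX_i`. -/
def IsExceptionalWrt {n : ℕ} (S : Set (EuclideanSpace ℝ (Fin n))) (i : Fin n) : Prop :=
  ∃ W ∈ vertices S, Metric.infDist W (axis i) = 1 ∧
    IsExposed ℝ S (convexHull ℝ (vertices S \ {W})) ∧
    dim (convexHull ℝ (vertices S \ {W})) + 2 = n ∧
    ∃ j, axis i ⊆ coordHyperplane j ∧ convexHull ℝ (vertices S \ {W}) ⊆ coordHyperplane j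

/-- `E_f`: the set of exceptional faces of `f`. -/
def exceptionalFaces {n : ℕ} (f : (Fin n → ℂ) → ℂ) : Set (Set (EuclideanSpace ℝ (Fin n))) :=
  {S | S ∈ newtonFaces f (n - 1) ∧ ∃ i, IsExceptionalWrt S i}

end NewtonDiagram

end

/-! Only the support `A` of the Taylor series matters, and only through `IsolatedSupport`: no
monomials of order below two, a monomial within lattice distance one of each axis, and one in each
coordinate plane. Failure of either of the last two would make the gradient vanish along a curve
through the origin (`isolatedSupport`). A compact face has a strictly positive normal `u`, so it is
the hull of the finite set `minSet A u`; it is two-dimensional iff `Full A u`, and exceptional iff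
`Exc A u`. The rest is a walk along faces, driven by tilting `u`.

Two mechanisms carry the walk. First, `exc_of_edge`: an edge joining `e_j + e_k` to the third axis
makes every full face exceptional. Since some full face is unexceptional, such edges are excluded,
and every degenerate case is reduced to one of them or to a clash with `IsolatedSupport`. Secondly,
`exists_touches_of_bridge`: a bridge over `OX_i` is an edge between the two planes through `OX_i`
with an end at distance one from the axis, as in condition (ii). Rotating the normal about it, away
from the axis, gives an adjacent full face. If that face is exceptional, it is a thin pyramid having
a bridge strictly farther out; coordinates of minimal points are bounded, so the process stops at an
unexceptional face.

It remains to start the walk (`exists_touches`). If the support misses `OX_i`, a monomial near the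
axis yields a bridge. If it meets `OX_i`, there is a full face at the lowest point of the axis; when
that face is exceptional, either it contains a bridge, or its neighbour across an edge through the
axis point is unexceptional. -/

noncomputable section

namespace NewtonDiagram

/-- The pairing `⟨u, ν⟩` of a real weight vector with a lattice point. -/
def weight {n : ℕ} (u : Fin n → ℝ) (ν : Fin n → ℕ) : ℝ := ∑ l, u l * ν l

/-- The points of `A` of minimal weight. -/
def minSet {n : ℕ} (A : Set (Fin n → ℕ)) (u : Fin n → ℝ) : Set (Fin n → ℕ) :=
  {ν | ν ∈ A ∧ ∀ μ ∈ A, weight u ν ≤ weight u μ}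

/-! ### Tilting weights on a set of lattice points -/

section Weight

variable {n : ℕ} {A : Set (Fin n → ℕ)} {u w : Fin n → ℝ}

theorem weight_add_mul (u w : Fin n → ℝ) (t : ℝ) (ν : Fin n → ℕ) :
    weight (fun l => u l + t * w l) ν = weight u ν + t * weight w ν := by
  simp only [weight, Finset.mul_sum, ← Finset.sum_add_distrib]
  exact Finset.sum_congr rfl fun l _ => by ring

theorem weight_mono (hu : ∀ l, 0 ≤ u l) {μ ν : Fin n → ℕ} (h : μ ≤ ν) :
    weight u μ ≤ weight u ν :=
  Finset.sum_le_sum fun l _ => mul_le_mul_of_nonneg_left (by exact_mod_cast h l) (hu l)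

theorem weight_strictMono (hu : ∀ l, 0 < u l) {μ ν : Fin n → ℕ} (h : μ ≤ ν)
    (hw : weight u ν ≤ weight u μ) : μ = ν := by
  by_contra hne
  obtain ⟨l, hl⟩ : ∃ l, μ l ≠ ν l := Function.ne_iff.mp hne
  refine absurd hw (not_le.mpr (Finset.sum_lt_sum
    (fun l _ => mul_le_mul_of_nonneg_left (by exact_mod_cast h l) (hu l).le)
    ⟨l, Finset.mem_univ l, mul_lt_mul_of_pos_left ?_ (hu l)⟩))
  exact_mod_cast lt_of_le_of_ne (h l) hl

theorem weight_eq_of_mem_minSet {μ ν : Fin n → ℕ} (hμ : μ ∈ minSet A u) (hν : ν ∈ minSet A u) :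
    weight u μ = weight u ν :=
  le_antisymm (hμ.2 ν hν.1) (hν.2 μ hμ.1)

theorem mem_minSet_of_weight_le {μ ν : Fin n → ℕ} (hμ : μ ∈ minSet A u) (hν : ν ∈ A)
    (h : weight u ν ≤ weight u μ) : ν ∈ minSet A u :=
  ⟨hν, fun ρ hρ => h.trans (hμ.2 ρ hρ)⟩

/-- Dickson's lemma. It makes the polyhedron finitely generated: with nonnegative weights only these
points have to be compared. -/
theorem finite_minimal (A : Set (Fin n → ℕ)) : {ν | Minimal (· ∈ A) ν}.Finite :=
  WellQuasiOrderedLE.finite_of_isAntichain (setOfPred_minimal_antichain _)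

theorem exists_minimal_le {ν : Fin n → ℕ} (hν : ν ∈ A) : ∃ μ, Minimal (· ∈ A) μ ∧ μ ≤ ν := by
  obtain ⟨μ, hμν, hμ⟩ := exists_minimal_le_of_wellFoundedLT (· ∈ A) ν hν
  exact ⟨μ, hμ, hμν⟩

theorem minimal_of_mem_minSet (hu : ∀ l, 0 < u l) {ν : Fin n → ℕ} (hν : ν ∈ minSet A u) :
    Minimal (· ∈ A) ν :=
  ⟨hν.1, fun _ hμ hle => (weight_strictMono hu hle (hν.2 _ hμ)).ge⟩

theorem minSet_finite (hu : ∀ l, 0 < u l) : (minSet A u).Finite :=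
  (finite_minimal A).subset fun _ hν => minimal_of_mem_minSet hu hν

theorem minSet_nonempty (hu : ∀ l, 0 ≤ u l) (hA : A.Nonempty) : (minSet A u).Nonempty := by
  obtain ⟨ν, hν⟩ := hA
  obtain ⟨μ, hμ, -⟩ := exists_minimal_le hν
  obtain ⟨ρ, hρ, hmin⟩ := Set.exists_min_image _ (weight u) (finite_minimal A) ⟨μ, hμ⟩
  refine ⟨ρ, hρ.1, fun σ hσ => ?_⟩
  obtain ⟨τ, hτ, hle⟩ := exists_minimal_le hσ
  exact (hmin τ hτ).trans (weight_mono hu hle)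

theorem mem_minSet_of_forall_minimal (hu : ∀ l, 0 ≤ u l) {P : Fin n → ℕ} (hP : P ∈ A)
    (h : ∀ μ, Minimal (· ∈ A) μ → weight u P ≤ weight u μ) : P ∈ minSet A u := by
  refine ⟨hP, fun σ hσ => ?_⟩
  obtain ⟨τ, hτ, hle⟩ := exists_minimal_le hσ
  exact (h τ hτ).trans (weight_mono hu hle)

/-- Moving the weight in a direction `w`, a minimal point stays minimal until either a point of
smaller `w`-weight becomes minimal too or the positive orthant is left. -/
theorem minSet_advance (hu : ∀ l, 0 < u l) {P : Fin n → ℕ} (hP : P ∈ minSet A u)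
    (w : Fin n → ℝ) :
    (∃ t : ℝ, 0 ≤ t ∧ (∀ l, 0 < u l + t * w l) ∧ P ∈ minSet A (fun l => u l + t * w l) ∧
      ∃ ν ∈ minSet A (fun l => u l + t * w l), weight w ν < weight w P) ∨
    ∀ t : ℝ, 0 ≤ t → (∀ l, 0 < u l + t * w l) → P ∈ minSet A (fun l => u l + t * w l) := by
  set N := {ν | Minimal (· ∈ A) ν ∧ weight w ν < weight w P} with hN
  have hNfin : N.Finite := (finite_minimal A).subset fun _ h => h.1
  -- The time at which `ν` ties with `P`; only points of smaller `w`-weight can ever catch up.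
  set ρ : (Fin n → ℕ) → ℝ := fun ν => (weight u ν - weight u P) / (weight w P - weight w ν)
  have key : ∀ t : ℝ, 0 ≤ t → (∀ l, 0 < u l + t * w l) → (∀ ν ∈ N, t ≤ ρ ν) →
      P ∈ minSet A (fun l => u l + t * w l) := by
    intro t ht hpos hle
    refine mem_minSet_of_forall_minimal (fun l => (hpos l).le) hP.1 fun μ hμ => ?_
    rw [weight_add_mul, weight_add_mul]
    by_cases hw : weight w μ < weight w P
    · have := hle μ ⟨hμ, hw⟩
      rw [le_div_iff₀ (sub_pos.mpr hw)] at this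
      linarith
    · have := mul_le_mul_of_nonneg_left (not_lt.mp hw) ht
      linarith [hP.2 μ hμ.1]
  by_cases hne : N.Nonempty
  · obtain ⟨ν, hν, hmin⟩ := Set.exists_min_image N ρ hNfin hne
    have hd : 0 < weight w P - weight w ν := sub_pos.mpr hν.2
    have h0 : 0 ≤ ρ ν := div_nonneg (sub_nonneg.mpr (hP.2 ν hν.1.1)) hd.le
    by_cases hpos : ∀ l, 0 < u l + ρ ν * w l
    · left
      have hPm := key _ h0 hpos hmin
      refine ⟨ρ ν, h0, hpos, hPm, ν, mem_minSet_of_weight_le hPm hν.1.1 ?_, hν.2⟩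
      rw [weight_add_mul, weight_add_mul]
      have : ρ ν * (weight w P - weight w ν) = weight u ν - weight u P :=
        div_mul_cancel₀ _ hd.ne'
      linarith
    · right
      intro t ht htpos
      refine key t ht htpos fun μ hμ => le_trans ?_ (hmin μ hμ)
      -- The positive orthant is convex: were an admissible `t` beyond the first tie, the tie would
      -- be inside the orthant too.
      by_contra hlt
      push Not at hlt
      refine hpos fun l => ?_
      rcases le_total 0 (w l) with h | h
      · linarith [hu l, mul_nonneg h0 h]
      · linarith [htpos l, mul_le_mul_of_nonpos_right hlt.le h]
  · right
    intro t ht htpos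
    exact key t ht htpos fun μ hμ => absurd ⟨μ, hμ⟩ hne

/-- A small move of the weight in direction `w` selects the minimal points of least
`w`-weight. -/
theorem minSet_perturb (hu : ∀ l, 0 < u l) {P : Fin n → ℕ} (hP : P ∈ minSet A u)
    (w : Fin n → ℝ) (hPw : ∀ ν ∈ minSet A u, weight w P ≤ weight w ν) :
    ∃ t : ℝ, 0 < t ∧ (∀ l, 0 < u l + t * w l) ∧
      ∀ ν, ν ∈ minSet A (fun l => u l + t * w l) ↔ ν ∈ minSet A u ∧ weight w ν = weight w P := by
  have h1 : ∀ᶠ t : ℝ in 𝓝[>] 0, ∀ l, 0 < u l + t * w l := by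
    rw [Filter.eventually_all]
    intro l
    have : Filter.Tendsto (fun t : ℝ => u l + t * w l) (𝓝 0) (𝓝 (u l + 0 * w l)) :=
      (by fun_prop : Continuous fun t : ℝ => u l + t * w l).tendsto 0
    rw [zero_mul, add_zero] at this
    exact (this.eventually (lt_mem_nhds (hu l))).filter_mono nhdsWithin_le_nhds
  -- Points not minimal for `u` lose by a fixed gap, and only finitely many matter, so a small tilt
  -- cannot bring them in.
  have h2 : ∀ᶠ t : ℝ in 𝓝[>] 0, ∀ μ ∈ {μ | Minimal (· ∈ A) μ}, μ ∈ minSet A u ∨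
      weight u P + t * weight w P < weight u μ + t * weight w μ := by
    rw [Filter.eventually_all_finite (finite_minimal A)]
    intro μ hμ
    by_cases hm : μ ∈ minSet A u
    · exact Filter.Eventually.of_forall fun _ => Or.inl hm
    have hlt : weight u P < weight u μ :=
      lt_of_not_ge fun h => hm (mem_minSet_of_weight_le hP hμ.1 h)
    have : Filter.Tendsto (fun t : ℝ => weight u μ + t * weight w μ -
        (weight u P + t * weight w P)) (𝓝 0) (𝓝 (weight u μ + 0 * weight w μ -
        (weight u P + 0 * weight w P))) :=
      (by fun_prop : Continuous fun t : ℝ => weight u μ + t * weight w μ -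
        (weight u P + t * weight w P)).tendsto 0
    have := (this.eventually (lt_mem_nhds (a := 0) (by linarith))).filter_mono
      (nhdsWithin_le_nhds (s := Ioi 0))
    filter_upwards [this] with t ht
    exact Or.inr (sub_pos.mp ht)
  obtain ⟨t, ⟨h1, h2⟩, ht⟩ := ((h1.and h2).and self_mem_nhdsWithin).exists
  replace ht : 0 < t := ht
  have hPm : P ∈ minSet A (fun l => u l + t * w l) := by
    refine mem_minSet_of_forall_minimal (fun l => (h1 l).le) hP.1 fun μ hμ => ?_
    rw [weight_add_mul, weight_add_mul]
    rcases h2 μ hμ with h | h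
    · have := mul_le_mul_of_nonneg_left (hPw μ h) ht.le
      linarith [hP.2 μ hμ.1]
    · exact h.le
  refine ⟨t, ht, h1, fun ν => ⟨fun hν => ?_, fun hν => ?_⟩⟩
  · have hle := hν.2 P hP.1
    rw [weight_add_mul, weight_add_mul] at hle
    rcases h2 ν (minimal_of_mem_minSet h1 hν) with h | h
    · refine ⟨h, le_antisymm ?_ (hPw ν h)⟩
      have := weight_eq_of_mem_minSet h hP
      exact le_of_mul_le_mul_left (by linarith) ht
    · linarith
  · refine mem_minSet_of_weight_le hPm hν.1.1 ?_
    rw [weight_add_mul, weight_add_mul, hν.2, weight_eq_of_mem_minSet hν.1 hP]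

/-- Minimality passes to the limit along a ray of weights. -/
theorem weight_le_of_forall_lt {P : Fin n → ℕ} {T : ℝ} (hT : 0 < T)
    (h : ∀ t : ℝ, 0 ≤ t → t < T → P ∈ minSet A (fun l => u l + t * w l))
    {ν : Fin n → ℕ} (hν : ν ∈ A) :
    weight u P + T * weight w P ≤ weight u ν + T * weight w ν := by
  have hev : ∀ᶠ t : ℝ in 𝓝[<] T,
      weight u P + t * weight w P ≤ weight u ν + t * weight w ν := by
    filter_upwards [self_mem_nhdsWithin, mem_nhdsWithin_of_mem_nhds (lt_mem_nhds hT)] with t h1 h2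
    have := (h t (le_of_lt h2) h1).2 ν hν
    rwa [weight_add_mul, weight_add_mul] at this
  have hc : ∀ a b : ℝ, Filter.Tendsto (fun t : ℝ => a + t * b) (𝓝[<] T) (𝓝 (a + T * b)) :=
    fun a b => ((by fun_prop : Continuous fun t : ℝ => a + t * b).tendsto T).mono_left
      nhdsWithin_le_nhds
  exact le_of_tendsto_of_tendsto (hc _ _) (hc _ _) hev

end Weight

/-- A lattice point as a point of Euclidean space. -/
def latticePoint {n : ℕ} (ν : Fin n → ℕ) : EuclideanSpace ℝ (Fin n) :=
  WithLp.toLp 2 fun l => (ν l : ℝ)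

/-- The weight `u` selects a set of points of `A` that is not contained in a line. -/
def Full {n : ℕ} (A : Set (Fin n → ℕ)) (u : Fin n → ℝ) : Prop :=
  ¬ Collinear ℝ (latticePoint '' minSet A u)

/-- `ν` lies on the line through `P` and `Q`. -/
def OnLine {n : ℕ} (P Q ν : Fin n → ℕ) : Prop :=
  ∃ r : ℝ, ∀ l, (ν l : ℝ) = P l + r * (Q l - P l)

/-- The face selected by `u` is a pyramid of height one over a base in a coordinate plane
`x_j = 0`, with its apex in another coordinate plane `x_k = 0`. -/
def Exc (A : Set (Fin 3 → ℕ)) (u : Fin 3 → ℝ) : Prop :=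
  ∃ j k : Fin 3, j ≠ k ∧ ∃ P ∈ minSet A u, P j = 1 ∧ P k = 0 ∧
    ∀ ν ∈ minSet A u, ν ≠ P → ν j = 0

/-- The properties of the support of an isolated singularity that matter for its Newton
diagram. -/
structure IsolatedSupport (A : Set (Fin 3 → ℕ)) : Prop where
  order : ∀ ν ∈ A, 2 ≤ ∑ l, ν l
  near_axis : ∀ i j k : Fin 3, i ≠ j → i ≠ k → j ≠ k → ∃ ν ∈ A, ν j + ν k ≤ 1
  meets_plane : ∀ i, ∃ ν ∈ A, ν i = 0

/-- The segment `PQ` is an edge joining the coordinate planes `x_j = 0` and `x_k = 0`, one of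
whose ends is at distance one from their intersection. -/
structure IsBridge (A : Set (Fin 3 → ℕ)) (j k : Fin 3) (P Q : Fin 3 → ℕ) (s : Fin 3 → ℝ) :
    Prop where
  pos : ∀ l, 0 < s l
  left_mem : P ∈ minSet A s
  right_mem : Q ∈ minSet A s
  onLine : ∀ ν ∈ minSet A s, OnLine P Q ν
  left_zero : P j = 0
  left_pos : 0 < P k
  right_zero : Q k = 0
  right_pos : 0 < Q j
  near : P k = 1 ∨ Q j = 1

theorem latticePoint_apply {n : ℕ} (ν : Fin n → ℕ) (l : Fin n) : latticePoint ν l = ν l := rfl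

theorem latticePoint_injective {n : ℕ} : Function.Injective (latticePoint (n := n)) := by
  intro μ ν h
  ext l
  have := congrArg (fun x : EuclideanSpace ℝ (Fin n) => x l) h
  simpa [latticePoint_apply] using this

/-! ### Lattice points on a line -/

section Line

variable {n : ℕ} {A : Set (Fin n → ℕ)} {u : Fin n → ℝ} {P Q ν : Fin n → ℕ}

theorem onLine_iff : OnLine P Q ν ↔ latticePoint ν ∈ line[ℝ, latticePoint P, latticePoint Q] := by
  rw [_root_.mem_affineSpan_pair_iff_exists_lineMap_eq]
  refine exists_congr fun r => ?_
  constructor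
  · intro h
    ext l
    simp only [AffineMap.lineMap_apply, vsub_eq_sub, vadd_eq_add, PiLp.add_apply, PiLp.smul_apply,
      PiLp.sub_apply, latticePoint_apply, smul_eq_mul, h l]
    ring
  · intro h l
    have := congrArg (fun x : EuclideanSpace ℝ (Fin n) => x l) h
    simp only [AffineMap.lineMap_apply, vsub_eq_sub, vadd_eq_add, PiLp.add_apply,
      PiLp.smul_apply, PiLp.sub_apply, latticePoint_apply, smul_eq_mul] at this
    linarith

theorem OnLine.symm (h : OnLine P Q ν) : OnLine Q P ν := by
  rw [onLine_iff] at h ⊢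
  rwa [Set.pair_comm]

theorem OnLine.weight_eq (h : OnLine P Q ν) {w : Fin n → ℝ} (hw : weight w P = weight w Q) :
    weight w ν = weight w P := by
  obtain ⟨r, hr⟩ := h
  have : weight w ν = weight w P + r * (weight w Q - weight w P) := by
    simp only [weight, ← Finset.sum_sub_distrib, Finset.mul_sum, ← Finset.sum_add_distrib]
    exact Finset.sum_congr rfl fun l _ => by rw [hr l]; ring
  rw [this, hw]; ring

theorem onLine_of_not_full (h : ¬ Full A u) (hP : P ∈ minSet A u) (hQ : Q ∈ minSet A u)
    (hPQ : P ≠ Q) (hν : ν ∈ minSet A u) : OnLine P Q ν := by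
  rw [onLine_iff]
  exact (not_not.mp h).mem_affineSpan_of_mem_of_ne ⟨P, hP, rfl⟩ ⟨Q, hQ, rfl⟩ ⟨ν, hν, rfl⟩
    (latticePoint_injective.ne hPQ)

theorem collinear_of_onLine {V : Set (Fin n → ℕ)} (h : ∀ ν ∈ V, OnLine P Q ν) :
    Collinear ℝ (latticePoint '' V) := by
  rw [collinear_iff_exists_forall_eq_smul_vadd]
  refine ⟨latticePoint P, latticePoint Q - latticePoint P, ?_⟩
  rintro _ ⟨ν, hν, rfl⟩
  obtain ⟨r, hr⟩ := h ν hν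
  refine ⟨r, ?_⟩
  ext l
  simp only [vadd_eq_add, PiLp.add_apply, PiLp.smul_apply, PiLp.sub_apply, latticePoint_apply,
    smul_eq_mul, hr l]
  ring

theorem Full.exists_not_onLine (h : Full A u) (P Q : Fin n → ℕ) :
    ∃ ν ∈ minSet A u, ¬ OnLine P Q ν := by
  by_contra! hc
  exact h (collinear_of_onLine hc)

theorem onLine_left : OnLine P Q P := ⟨0, by simp⟩

theorem onLine_right : OnLine P Q Q := ⟨1, by simp⟩

/-- A functional agreeing at `P` and `Q` is constant on their line. Hence a weight rotated about the
edge `PQ` becomes full as soon as it picks up a point of different `w`-weight. -/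
theorem full_of_weight_ne (hP : P ∈ minSet A u) (hQ : Q ∈ minSet A u) (hPQ : P ≠ Q)
    (hν : ν ∈ minSet A u) {w : Fin n → ℝ} (hw : weight w P = weight w Q)
    (hne : weight w ν ≠ weight w P) : Full A u := by
  by_contra h
  exact hne ((onLine_of_not_full h hP hQ hPQ hν).weight_eq hw)

end Line

theorem sum_distinct {M : Type*} [AddCommMonoid M] {i j k : Fin 3} (hij : i ≠ j) (hik : i ≠ k)
    (hjk : j ≠ k) (g : Fin 3 → M) : ∑ l, g l = g i + g j + g k := by
  have : (Finset.univ : Finset (Fin 3)) = {i, j, k} := by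
    revert i j k; decide
  rw [this, Finset.sum_insert (by simp [hij, hik]), Finset.sum_pair hjk, add_assoc]

theorem weight_distinct {i j k : Fin 3} (hij : i ≠ j) (hik : i ≠ k)
    (hjk : j ≠ k) (u : Fin 3 → ℝ) (ν : Fin 3 → ℕ) :
    weight u ν = u i * ν i + u j * ν j + u k * ν k :=
  sum_distinct hij hik hjk _

theorem forall_distinct {i j k : Fin 3} (hij : i ≠ j) (hik : i ≠ k) (hjk : j ≠ k)
    {p : Fin 3 → Prop} (hi : p i) (hj : p j) (hk : p k) : ∀ l, p l := by
  intro l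
  have : l = i ∨ l = j ∨ l = k := by clear hi hj hk; revert i j k l; decide
  rcases this with rfl | rfl | rfl <;> assumption

theorem exists_vector {i j k : Fin 3} (hij : i ≠ j) (hik : i ≠ k) (hjk : j ≠ k) (a b c : ℝ) :
    ∃ w : Fin 3 → ℝ, w i = a ∧ w j = b ∧ w k = c :=
  ⟨fun l => if l = i then a else if l = j then b else c, by simp, by simp [hij.symm],
    by simp [hik.symm, hjk.symm]⟩

theorem ext_distinct {i j k : Fin 3} (hij : i ≠ j) (hik : i ≠ k) (hjk : j ≠ k)
    {μ ν : Fin 3 → ℕ} (hi : μ i = ν i) (hj : μ j = ν j) (hk : μ k = ν k) : μ = ν :=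
  funext (forall_distinct hij hik hjk hi hj hk)

theorem exists_third {j k : Fin 3} (hjk : j ≠ k) : ∃ i, i ≠ j ∧ i ≠ k := by
  revert j k; decide

theorem exists_others (i : Fin 3) : ∃ j k, i ≠ j ∧ i ≠ k ∧ j ≠ k := by
  revert i; decide

/-! ### Edges that force every face to be exceptional -/

section Combinatorics

variable {A : Set (Fin 3 → ℕ)}

/-- Points of least weight in a common coordinate plane are collinear. -/
theorem collinear_of_subset_plane {u : Fin 3 → ℝ} (hu : ∀ l, 0 < u l)
    {V : Set (Fin 3 → ℕ)} (hV : V ⊆ minSet A u) {j : Fin 3} (hj : ∀ ν ∈ V, ν j = 0) :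
    Collinear ℝ (latticePoint '' V) := by
  obtain ⟨i, k, hji, hjk, hik⟩ := exists_others j
  rcases V.eq_empty_or_nonempty with rfl | ⟨P, hP⟩
  · simpa using collinear_empty ℝ _
  by_cases hQ : ∃ Q ∈ V, Q ≠ P
  · obtain ⟨Q, hQ, hne⟩ := hQ
    refine collinear_of_onLine (P := P) (Q := Q) fun ν hν => ?_
    have hw := fun μ (hμ : μ ∈ V) => weight_eq_of_mem_minSet (hV hμ) (hV hP)
    have h1 := hw ν hν
    have h2 := hw Q hQ
    simp only [weight_distinct hji.symm hik hjk, hj ν hν, hj Q hQ, hj P hP] at h1 h2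
    -- Within the plane the level set of `u` is a line on which `x_i` is a parameter, since `u k` is
    -- nonzero.
    have hk : (Q i : ℝ) - P i ≠ 0 := by
      intro h0
      have hi : Q i = P i := by exact_mod_cast sub_eq_zero.mp h0
      rw [hi] at h2
      refine hne (ext_distinct hji.symm hik hjk hi (by rw [hj Q hQ, hj P hP]) ?_)
      have : (Q k : ℝ) = P k := mul_left_cancel₀ (hu k).ne' (by linarith)
      exact_mod_cast this
    refine ⟨((ν i : ℝ) - P i) / (Q i - P i), forall_distinct hji.symm hik hjk ?_ ?_ ?_⟩
    · rw [div_mul_cancel₀ _ hk]; ring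
    · rw [hj ν hν, hj Q hQ, hj P hP]; simp
    · rw [div_mul_eq_mul_div, ← sub_eq_iff_eq_add', eq_div_iff hk]
      refine mul_left_cancel₀ (hu k).ne' ?_
      linear_combination (Q i - P i : ℝ) * h1 - (ν i - P i : ℝ) * h2
  · push Not at hQ
    refine (collinear_singleton ℝ (latticePoint P)).subset ?_
    rintro _ ⟨ν, hν, rfl⟩
    rw [hQ ν hν]; rfl

theorem Full.exists_ne_zero {u : Fin 3 → ℝ} (hu : ∀ l, 0 < u l) (h : Full A u) (j : Fin 3) :
    ∃ ν ∈ minSet A u, ν j ≠ 0 := by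
  by_contra! hc
  exact h (collinear_of_subset_plane hu subset_rfl hc)

/-- Planar estimate for `exc_of_edge`. Here `(e, d)` is a face point in a plane through the axis,
`τ` its weight for the face normal, and `m` the point on the axis. It says `vx / τ < x / (m * σ)`:
the face cuts the other axis farther out than the edge normal does. -/
theorem mul_lt_mul_of_edge {σ x vi vx τ m d e : ℝ} (hσ : 0 < σ) (hvi : 0 < vi) (hvx : 0 < vx)
    (he : 0 ≤ e) (hd : 1 ≤ d) (h1 : m * σ < d * x + e * σ) (h2 : d * vx + e * vi = τ)
    (h3 : τ ≤ m * vi) : vx * (m * σ) < τ * x := by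
  have hd' : 0 < d := by linarith
  have hτ : 0 < τ := by rw [← h2]; positivity
  have a0 : d * vx * m = (τ - e * vi) * m := by rw [← h2]; ring
  have a1 : d * vx * m ≤ τ * (m - e) := by linarith [mul_le_mul_of_nonneg_left h3 he]
  have a2 := mul_le_mul_of_nonneg_right a1 hσ.le
  have a3 : τ * (m * σ) < τ * (d * x + e * σ) := mul_lt_mul_of_pos_left h1 hτ
  refine lt_of_mul_lt_mul_left (a := d) ?_ hd'.le
  linarith

/-- If `P = e_j + e_k` and a point `W` of the third axis span an edge, then every full face is
exceptional. -/
theorem exc_of_edge {i j k : Fin 3} (hij : i ≠ j) (hik : i ≠ k) (hjk : j ≠ k)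
    {s : Fin 3 → ℝ} (hs : ∀ l, 0 < s l) {P W : Fin 3 → ℕ}
    (hP : P ∈ minSet A s) (hW : W ∈ minSet A s) (hPi : P i = 0) (hPj : P j = 1) (hPk : P k = 1)
    (hWj : W j = 0) (hWk : W k = 0) (hline : ∀ ν ∈ minSet A s, ν j = ν k)
    {v : Fin 3 → ℝ} (hv : ∀ l, 0 < v l) (hfull : Full A v) : Exc A v := by
  have hPle : ∀ ν : Fin 3 → ℕ, 1 ≤ ν j → 1 ≤ ν k → P ≤ ν := fun ν h1 h2 =>
    forall_distinct hij hik hjk (p := fun l => P l ≤ ν l) (by omega) (by omega) (by omega)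
  -- A point with both coordinates positive dominates `P = e_j + e_k`, so it cannot be minimal
  -- unless it is `P`.
  have hsub : ∀ ν ∈ minSet A v, ν ≠ P → ν j = 0 ∨ ν k = 0 := by
    intro ν hν hne
    by_contra! hc
    exact hne (weight_strictMono hv (hPle ν (by omega) (by omega)) (hν.2 P hP.1)).symm
  by_cases hx : ∃ ν ∈ minSet A v, ν k = 0 ∧ 1 ≤ ν j
  · by_cases hy : ∃ μ ∈ minSet A v, μ j = 0 ∧ 1 ≤ μ k
    -- With face points strictly on both sides of the edge, adding the two planar estimates gives
    -- `(v j + v k) / τ < (s j + s k) / (W i * s i) = 1`, so `P` would lie below the face. Otherwise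
    -- all points but `P` share one plane, and `P` is an apex of height one over it.
    · exfalso
      obtain ⟨ν, hν, hνk, hνj⟩ := hx
      obtain ⟨μ, hμ, hμj, hμk⟩ := hy
      have strict : ∀ ρ ∈ A, ρ j ≠ ρ k → weight s W < weight s ρ := fun ρ hρ hne =>
        lt_of_not_ge fun h => hne (hline ρ (mem_minSet_of_weight_le hW hρ h))
      have e1 := weight_eq_of_mem_minSet hP hW
      have e2 := strict ν hν.1 (by omega)
      have e3 := strict μ hμ.1 (by omega)
      have e4 := weight_eq_of_mem_minSet hν hμ
      have e5 := hν.2 P hP.1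
      have e6 := hν.2 W hW.1
      have e7 := hμ.2 W hW.1
      simp only [weight_distinct hij hik hjk, hPi, hPj, hPk, hWj, hWk, hνk, hμj] at e1 e2 e3 e4 e5 e6 e7
      have q1 : (1 : ℝ) ≤ ν j := by exact_mod_cast hνj
      have q2 : (1 : ℝ) ≤ μ k := by exact_mod_cast hμk
      have c1 := mul_lt_mul_of_edge (hs i) (hv i) (hv j) (Nat.cast_nonneg (ν i)) q1
        (m := W i) (x := s j) (τ := v i * ν i + v j * ν j)
        (by push_cast at e2; linarith) (by ring) (by push_cast at e6; linarith)
      have c2 := mul_lt_mul_of_edge (hs i) (hv i) (hv k) (Nat.cast_nonneg (μ i)) q2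
        (m := W i) (x := s k) (τ := v i * μ i + v k * μ k)
        (by push_cast at e3; linarith) (by ring) (by push_cast at e7; linarith)
      push_cast at e1 e4 e5
      have hτ : v i * μ i + v k * μ k = v i * ν i + v j * ν j := by linarith
      rw [hτ] at c2
      have hm : s j + s k = W i * s i := by linarith
      have hmp : 0 < (W i : ℝ) * s i := by rw [← hm]; linarith [hs j, hs k]
      have h5 : v i * ν i + v j * ν j ≤ v j + v k := by linarith
      have h6 := mul_le_mul_of_nonneg_right h5 hmp.le
      have h7 : (v i * ν i + v j * ν j) * (s j + s k) = (v i * ν i + v j * ν j) * (W i * s i) := by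
        rw [hm]
      linarith
    · push Not at hy
      have h0 : ∀ ν ∈ minSet A v, ν ≠ P → ν k = 0 := fun ν hν hne => by
        rcases hsub ν hν hne with h | h
        · have := hy ν hν h; omega
        · exact h
      refine ⟨k, i, hik.symm, P, ?_, hPk, hPi, h0⟩
      obtain ⟨ρ, hρ, hne⟩ := hfull.exists_ne_zero hv k
      by_cases hρP : ρ = P
      · rwa [← hρP]
      · exact absurd (h0 ρ hρ hρP) hne
  · push Not at hx
    have h0 : ∀ ν ∈ minSet A v, ν ≠ P → ν j = 0 := fun ν hν hne => by
      rcases hsub ν hν hne with h | h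
      · exact h
      · have := hx ν hν h; omega
    refine ⟨j, i, hij.symm, P, ?_, hPj, hPi, h0⟩
    obtain ⟨ρ, hρ, hne⟩ := hfull.exists_ne_zero hv j
    by_cases hρP : ρ = P
    · rwa [← hρP]
    · exact absurd (h0 ρ hρ hρP) hne

end Combinatorics

/-! ### Walking outwards along bridges -/

section Bridge

variable {A : Set (Fin 3 → ℕ)}

theorem IsBridge.symm {j k : Fin 3} {P Q : Fin 3 → ℕ} {s : Fin 3 → ℝ} (h : IsBridge A j k P Q s) :
    IsBridge A k j Q P s :=
  ⟨h.pos, h.right_mem, h.left_mem, fun ν hν => (h.onLine ν hν).symm, h.right_zero, h.right_pos,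
    h.left_zero, h.left_pos, h.near.symm⟩

/-- The face selected by `u` satisfies the conclusion of the theorem for the axis `OX_i`. -/
def Touches (A : Set (Fin 3 → ℕ)) (i : Fin 3) (u : Fin 3 → ℝ) : Prop :=
  (∃ W ∈ minSet A u, ∀ l, l ≠ i → W l = 0) ∨
    ∃ j k P Q s, j ≠ i ∧ k ≠ i ∧ j ≠ k ∧ IsBridge A j k P Q s ∧ P ∈ minSet A u ∧ Q ∈ minSet A u

theorem IsolatedSupport.two_le (hA : IsolatedSupport A) {i j k : Fin 3} (hij : i ≠ j)
    (hik : i ≠ k) (hjk : j ≠ k) {ν : Fin 3 → ℕ} (hν : ν ∈ A) : 2 ≤ ν i + ν j + ν k := by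
  rw [← sum_distinct hij hik hjk]; exact hA.order ν hν

/-- An exceptional face with apex at distance one from `x_k = 0` in `x_j = 0` contributes a
bridge. -/
theorem exists_bridge_of_apex {i j k : Fin 3} (hij : i ≠ j) (hik : i ≠ k) (hjk : j ≠ k)
    {v : Fin 3 → ℝ} (hv : ∀ l, 0 < v l) {P Y : Fin 3 → ℕ} (hP : P ∈ minSet A v)
    (hPj : P j = 0) (hPk : P k = 1) (hap : ∀ ν ∈ minSet A v, ν ≠ P → ν k = 0)
    (hY : Y ∈ minSet A v) (hYj : 0 < Y j) :
    ∃ Z s, IsBridge A j k P Z s ∧ Y j ≤ Z j := by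
  obtain ⟨Z, hZ, hmax⟩ := Set.exists_max_image (minSet A v) (fun ν => ν j) (minSet_finite hv) ⟨Y, hY⟩
  have hZj : 0 < Z j := hYj.trans_le (hmax Y hY)
  have hZP : Z ≠ P := by rintro rfl; omega
  have hZk := hap Z hZ hZP
  -- Chosen so that `P` ties with the base points of largest `x_j`; the base lies in a plane, so `Z`
  -- is the only such point.
  obtain ⟨w, hwi, hwj, hwk⟩ := exists_vector hij hik hjk 0 (-1) (-(Z j : ℝ))
  have hwP : weight w P = -(Z j : ℝ) := by
    rw [weight_distinct hij hik hjk, hwi, hwj, hwk, hPj, hPk]; simp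
  have hwν : ∀ ν ∈ minSet A v, ν ≠ P → weight w ν = -(ν j : ℝ) := fun ν hν hne => by
    rw [weight_distinct hij hik hjk, hwi, hwj, hwk, hap ν hν hne]; simp
  obtain ⟨t, -, hpos, hmem⟩ := minSet_perturb hv hP w fun ν hν => by
    by_cases h : ν = P
    · rw [h]
    · rw [hwP, hwν ν hν h, neg_le_neg_iff]
      exact_mod_cast hmax ν hν
  refine ⟨Z, _, ⟨hpos, (hmem P).mpr ⟨hP, rfl⟩, (hmem Z).mpr ⟨hZ, ?_⟩, fun ν hν => ?_, hPj,
    by omega, hZk, hZj, Or.inl hPk⟩, hmax Y hY⟩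
  · rw [hwν Z hZ hZP, hwP]
  · obtain ⟨hν1, hν2⟩ := (hmem ν).mp hν
    by_cases h : ν = P
    · rw [h]; exact onLine_left
    · rw [hwν ν hν1 h, hwP, neg_inj] at hν2
      have e1 : ν j = Z j := by exact_mod_cast hν2
      have e2 := hap ν hν1 h
      have e3 := weight_eq_of_mem_minSet hν1 hZ
      rw [weight_distinct hij hik hjk, weight_distinct hij hik hjk, e1, e2, hZk] at e3
      have e4 : (ν i : ℝ) = Z i := mul_left_cancel₀ (hv i).ne' (by linarith)
      have : ν = Z := ext_distinct hij hik hjk (by exact_mod_cast e4) e1 (by rw [e2, hZk])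
      rw [this]; exact onLine_right

/-- A bridge that can be followed up to the boundary of the orthant forces all full faces to be
exceptional. -/
theorem exc_of_bridge_end (hA : IsolatedSupport A) {i j k : Fin 3} (hij : i ≠ j) (hik : i ≠ k)
    (hjk : j ≠ k) {P Q : Fin 3 → ℕ} {s : Fin 3 → ℝ} (hb : IsBridge A j k P Q s) {σ y : ℝ}
    (hσ : 0 < σ) (hy : 0 ≤ y) (hle : ∀ ν ∈ A, P i * σ + P k * y ≤ ν i * σ + ν k * y)
    (hPQ : P i * σ + P k * y = Q i * σ) {v : Fin 3 → ℝ} (hv : ∀ l, 0 < v l) (hfull : Full A v) :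
    Exc A v := by
  have hPA := hb.left_mem.1
  have hQA := hb.right_mem.1
  have h2P := hA.two_le hij hik hjk hPA
  have h2Q := hA.two_le hij hik hjk hQA
  have hPj := hb.left_zero
  have hQk := hb.right_zero
  have hPk : (1 : ℝ) ≤ P k := by exact_mod_cast hb.left_pos
  have hnear := hb.near
  have hPi0 : (0 : ℝ) ≤ P i := Nat.cast_nonneg _
  -- The limiting normal is `(σ, 0, y)` in the order `i, j, k`. If also `y = 0`, a monomial in `x_i
  -- = 0` pushes `P` and `Q` onto axes, and order at least two contradicts `near`.
  rcases hy.eq_or_lt with rfl | hy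
  · exfalso
    obtain ⟨ν, hν, hνi⟩ := hA.meets_plane i
    have h1 := hle ν hν
    rw [hνi] at h1
    simp only [mul_zero, add_zero, Nat.cast_zero, zero_mul] at h1 hPQ
    have h3 : (P i : ℝ) = 0 := le_antisymm (nonpos_of_mul_nonpos_left h1 hσ) hPi0
    have h4 : (Q i : ℝ) = P i := (mul_right_cancel₀ hσ.ne' hPQ).symm
    have h5 : P i = 0 := by exact_mod_cast h3
    have h6 : Q i = 0 := by rw [h5] at h4; exact_mod_cast h4
    omega
  have hQi : 0 < (Q i : ℝ) * σ := by rw [← hPQ]; nlinarith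
  -- The limiting normal ignores `x_j`, so a monomial near `OX_j` has weight at most `σ` or `y`. The
  -- only surviving case is `Q = e_i + e_j` with `P` on `OX_k`, where `exc_of_edge` applies.
  obtain ⟨ν, hν, hν1⟩ := hA.near_axis j i k hij.symm hjk hik
  have h1 := hle ν hν
  have hνc : (ν i = 0 ∧ ν k = 0) ∨ (ν i = 1 ∧ ν k = 0) ∨ (ν i = 0 ∧ ν k = 1) := by omega
  rcases hνc with ⟨e1, e2⟩ | ⟨e1, e2⟩ | ⟨e1, e2⟩ <;> rw [e1, e2] at h1 <;>
    simp only [Nat.cast_zero, Nat.cast_one, zero_mul, one_mul, add_zero, zero_add] at h1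
  · linarith
  · have hQ1 : (Q i : ℝ) ≤ 1 := by
      by_contra! h
      nlinarith
    have hQ0 : (0 : ℝ) < Q i := pos_of_mul_pos_left hQi hσ.le
    have hQi1 : Q i = 1 := by
      have h3 : Q i ≤ 1 := by exact_mod_cast hQ1
      have h4 : 0 < Q i := by exact_mod_cast hQ0
      omega
    have hPi : P i = 0 := by
      by_contra h
      have h3 : (1 : ℝ) ≤ P i := by exact_mod_cast Nat.one_le_iff_ne_zero.mpr h
      nlinarith
    have hQj : Q j = 1 := by omega
    refine exc_of_edge hik.symm hjk.symm hij hb.pos hb.right_mem hb.left_mem hQk hQi1 hQj hPi hPj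
      (fun ρ hρ => ?_) hv hfull
    obtain ⟨r, hr⟩ := hb.onLine ρ hρ
    have h3 := hr i
    have h4 := hr j
    rw [hPi, hQi1] at h3
    rw [hPj, hQj] at h4
    have : (ρ i : ℝ) = ρ j := by rw [h3, h4]
    exact_mod_cast this
  · exfalso
    have hPi : P i = 0 := by
      by_contra h
      have h3 : (1 : ℝ) ≤ P i := by exact_mod_cast Nat.one_le_iff_ne_zero.mpr h
      nlinarith
    have hPk1 : (P k : ℝ) ≤ 1 := by
      by_contra! h
      rw [hPi] at h1
      simp only [Nat.cast_zero, zero_mul, zero_add] at h1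
      nlinarith
    have : P k ≤ 1 := by exact_mod_cast hPk1
    omega

/-- If a bridge and a full unexceptional face exist, then there is a full unexceptional face
touching the axis. -/
theorem exists_touches_of_bridge (hA : IsolatedSupport A) {v₀ : Fin 3 → ℝ} (hv₀ : ∀ l, 0 < v₀ l)
    (hfull₀ : Full A v₀) (hexc₀ : ¬ Exc A v₀) {N : ℕ} (hN : ∀ ν, Minimal (· ∈ A) ν → ∀ l, ν l ≤ N)
    (n : ℕ) : ∀ {i j k : Fin 3}, i ≠ j → i ≠ k → j ≠ k → ∀ {P Q : Fin 3 → ℕ} {s : Fin 3 → ℝ},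
      IsBridge A j k P Q s → 2 * N < P k + Q j + n →
      ∃ u, (∀ l, 0 < u l) ∧ Full A u ∧ ¬ Exc A u ∧ Touches A i u := by
  induction n with
  | zero =>
    intro i j k hij hik hjk P Q s hb hn
    have h1 := hN P (minimal_of_mem_minSet hb.pos hb.left_mem) k
    have h2 := hN Q (minimal_of_mem_minSet hb.pos hb.right_mem) j
    omega
  | succ n ih =>
    intro i j k hij hik hjk P Q s hb hn
    have hPj := hb.left_zero
    have hQk := hb.right_zero
    have hPk := hb.left_pos
    have hQj := hb.right_pos
    have hPk' : (0 : ℝ) < P k := by exact_mod_cast hPk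
    have hQj' : (0 : ℝ) < Q j := by exact_mod_cast hQj
    have hPQ : P ≠ Q := by rintro rfl; omega
    have h2P := hA.two_le hij hik hjk hb.left_mem.1
    have h2Q := hA.two_le hij hik hjk hb.right_mem.1
    -- The direction fixing the edge `PQ` and leaving the `i`-th weight unchanged; it favours points
    -- farther from `OX_i`. The induction parameter `n` bounds how much `P k + Q j` can still grow.
    obtain ⟨w, hwi, hwj, hwk⟩ := exists_vector hij hik hjk 0 (-(P k : ℝ)) (-(Q j : ℝ))
    have hw : ∀ ν, weight w ν = -(P k * ν j + Q j * ν k : ℝ) := fun ν => by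
      rw [weight_distinct hij hik hjk, hwi, hwj, hwk]; ring
    have hwPQ : weight w P = weight w Q := by rw [hw, hw, hPj, hQk]; ring
    have hQmem : ∀ t : ℝ, P ∈ minSet A (fun l => s l + t * w l) →
        Q ∈ minSet A (fun l => s l + t * w l) := fun t h =>
      mem_minSet_of_weight_le h hb.right_mem.1 (by
        rw [weight_add_mul, weight_add_mul, hwPQ,
          weight_eq_of_mem_minSet hb.left_mem hb.right_mem])
    rcases minSet_advance hb.pos hb.left_mem w with ⟨t, ht, hpos, hPm, ν, hν, hlt⟩ | hall
    · set v := fun l => s l + t * w l with hvdef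
      have hQm := hQmem t hPm
      have hfull : Full A v := full_of_weight_ne hPm hQm hPQ hν hwPQ hlt.ne
      by_cases hexc : Exc A v
      -- Points of the new face off the bridge had larger `s`-weight, so to tie now they must lie
      -- strictly beyond it.
      · have hbeyond : ∀ Y ∈ minSet A v, ¬ OnLine P Q Y → weight w Y < weight w P := by
          intro Y hY hn
          have h1 : weight s P < weight s Y := lt_of_not_ge fun h =>
            hn (hb.onLine Y (mem_minSet_of_weight_le hb.left_mem hY.1 h))
          have h2 := weight_eq_of_mem_minSet hY hPm
          rw [hvdef, weight_add_mul, weight_add_mul] at h2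
          by_contra! h3
          nlinarith [mul_le_mul_of_nonneg_left h3 ht]
        obtain ⟨Y, hY, hYn⟩ := hfull.exists_not_onLine P Q
        have hYw := hbeyond Y hY hYn
        have hYP : Y ≠ P := by rintro rfl; exact hYn onLine_left
        have hYQ : Y ≠ Q := by rintro rfl; exact hYn onLine_right
        rw [hw, hw, hPj] at hYw
        obtain ⟨j', k', hjk', R, hR, hRj, hRk, hap⟩ := hexc
        have hj' : j' = i ∨ j' = j ∨ j' = k :=
          forall_distinct hij hik hjk (p := fun l => l = i ∨ l = j ∨ l = k) (by simp) (by simp)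
            (by simp) j'
        rcases hj' with rfl | rfl | rfl
        -- Base in `x_i = 0`: at least one end of the bridge lies on an axis, hence at height two or
        -- more, so `near` makes the other end a sum of two unit vectors, or is contradicted
        -- outright.
        · exfalso
          have hline : ∀ ρ ∈ minSet A s, ∃ r : ℝ, ∀ l, (ρ l : ℝ) = P l + r * (Q l - P l) :=
            hb.onLine
          have hnear := hb.near
          by_cases hRP : R = P
          · subst hRP
            have hQi := hap Q hQm hPQ.symm
            have hPk1 : R k = 1 := by omega
            refine hexc₀ (exc_of_edge hij.symm hjk hik hb.pos hb.left_mem hb.right_mem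
              hPj hRj hPk1 hQi hQk (fun ρ hρ => ?_) hv₀ hfull₀)
            obtain ⟨r, hr⟩ := hline ρ hρ
            have h3 := hr j'
            have h4 := hr k
            rw [hRj, hQi] at h3
            rw [hPk1, hQk] at h4
            have : (ρ j' : ℝ) = ρ k := by rw [h3, h4]
            exact_mod_cast this
          · have hPi := hap P hPm (Ne.symm hRP)
            by_cases hRQ : R = Q
            · subst hRQ
              have hQj1 : R j = 1 := by omega
              refine hexc₀ (exc_of_edge hik.symm hjk.symm hij hb.pos hb.right_mem hb.left_mem
                hQk hRj hQj1 hPi hPj (fun ρ hρ => ?_) hv₀ hfull₀)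
              obtain ⟨r, hr⟩ := hline ρ hρ
              have h3 := hr j'
              have h4 := hr j
              rw [hRj, hPi] at h3
              rw [hQj1, hPj] at h4
              have : (ρ j' : ℝ) = ρ j := by rw [h3, h4]
              exact_mod_cast this
            · have hQi := hap Q hQm (Ne.symm hRQ)
              omega
        -- Base in `x_j = 0`: the apex must be `Q`, with `Q j = 1`, so being beyond the bridge means
        -- `Y k > P k`, and the bridge from `Q` within this face has a larger sum.
        · have hRQ : R = Q := by
            by_contra h
            have := hap Q hQm (Ne.symm h)
            omega
          subst hRQ
          have hYj := hap Y hY hYQ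
          rw [hYj] at hYw
          have hlt : P k < Y k := by
            have : (P k : ℝ) < Y k := by
              rw [hRj] at hYw
              push_cast at hYw
              linarith
            exact_mod_cast this
          obtain ⟨Z, s', hb', hZ⟩ := exists_bridge_of_apex hik hij hjk.symm hpos hR hQk hRj hap hY
            (by omega)
          exact ih hij hik hjk hb'.symm (by omega)
        · have hRP : R = P := by
            by_contra h
            have := hap P hPm (Ne.symm h)
            omega
          subst hRP
          have hYk := hap Y hY hYP
          rw [hYk] at hYw
          have hlt : Q j < Y j := by
            have : (Q j : ℝ) < Y j := by
              rw [hRj] at hYw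
              push_cast at hYw
              linarith
            exact_mod_cast this
          obtain ⟨Z, s', hb', hZ⟩ := exists_bridge_of_apex hij hik hjk hpos hR hPj hRj hap hY
            (by omega)
          exact ih hij hik hjk hb' (by omega)
      · exact ⟨v, hpos, hfull, hexc, Or.inr ⟨j, k, P, Q, s, hij.symm, hik.symm, hjk, hb, hPm, hQm⟩⟩
    · exfalso
      refine hexc₀ ?_
      have hTle : ∀ T : ℝ, 0 < T → T * P k ≤ s j → T * Q j ≤ s k → ∀ ν ∈ A,
          weight s P + T * weight w P ≤ weight s ν + T * weight w ν := by
        intro T hT h1 h2 ν hν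
        refine weight_le_of_forall_lt hT (fun t ht htT => hall t ht ?_) hν
        refine forall_distinct hij hik hjk ?_ ?_ ?_
        · rw [hwi]; simpa using hb.pos i
        · rw [hwj]; nlinarith [mul_lt_mul_of_pos_right htT hPk']
        · rw [hwk]; nlinarith [mul_lt_mul_of_pos_right htT hQj']
      have hsPQ := weight_eq_of_mem_minSet hb.left_mem hb.right_mem
      have hsj := hb.pos j
      have hsk := hb.pos k
      rw [weight_distinct hij hik hjk, weight_distinct hij hik hjk, hPj, hQk] at hsPQ
      push_cast at hsPQ
      -- Which of the `j`-th and `k`-th weights reaches zero first; the two cases are mirror images.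
      rcases le_total (s j / P k) (s k / Q j) with hc | hc
      · set T := s j / P k with hTdef
        have hT : 0 < T := div_pos hsj hPk'
        have e1 : T * P k = s j := div_mul_cancel₀ _ hPk'.ne'
        have e2 : T * Q j ≤ s k := (le_div_iff₀ hQj').mp hc
        refine exc_of_bridge_end hA hij hik hjk hb (hb.pos i) (sub_nonneg.mpr e2)
          (fun ν hν => ?_) ?_ hv₀ hfull₀
        · have := hTle T hT e1.le e2 ν hν
          rw [hw, hw, weight_distinct hij hik hjk, weight_distinct hij hik hjk, hPj, ← e1] at this
          push_cast at this
          linarith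
        · rw [← e1] at hsPQ
          linarith
      · set T := s k / Q j with hTdef
        have hT : 0 < T := div_pos hsk hQj'
        have e1 : T * Q j = s k := div_mul_cancel₀ _ hQj'.ne'
        have e2 : T * P k ≤ s j := (le_div_iff₀ hPk').mp hc
        refine exc_of_bridge_end hA hik hij hjk.symm hb.symm (hb.pos i) (sub_nonneg.mpr e2)
          (fun ν hν => ?_) ?_ hv₀ hfull₀
        · have := hTle T hT e2 e1.le ν hν
          rw [hw, hw, weight_distinct hij hik hjk, weight_distinct hij hik hjk, hPj, ← e1] at this
          rw [← e1] at hsPQ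
          push_cast at this
          linarith
        · rw [← e1] at hsPQ
          linarith

end Bridge

/-! ### Starting the walk at a given axis -/

section Touching

variable {A : Set (Fin 3 → ℕ)}

theorem exists_forall_nat_le {α : Type*} (g : α → ℕ) {s : Set α} (hs : s.Nonempty) :
    ∃ a ∈ s, ∀ b ∈ s, g a ≤ g b := by
  obtain ⟨a, ha, h⟩ := WellFounded.has_min (measure g).wf s hs
  exact ⟨a, ha, fun b hb => not_lt.mp (h b hb)⟩

theorem exists_touches_of_isBridge (hA : IsolatedSupport A) {v₀ : Fin 3 → ℝ}
    (hv₀ : ∀ l, 0 < v₀ l) (hfull₀ : Full A v₀) (hexc₀ : ¬ Exc A v₀) {i j k : Fin 3} (hij : i ≠ j)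
    (hik : i ≠ k) (hjk : j ≠ k) {P Q : Fin 3 → ℕ} {s : Fin 3 → ℝ} (hb : IsBridge A j k P Q s) :
    ∃ u, (∀ l, 0 < u l) ∧ Full A u ∧ ¬ Exc A u ∧ Touches A i u := by
  obtain ⟨b, hb'⟩ := (finite_minimal A).bddAbove
  refine exists_touches_of_bridge hA hv₀ hfull₀ hexc₀ (N := ∑ l, b l) (fun ν hν l => ?_)
    (2 * (∑ l, b l) + 1) hij hik hjk hb (by omega)
  exact (hb' hν l).trans (Finset.single_le_sum (f := b) (fun _ _ => Nat.zero_le _)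
    (Finset.mem_univ l))

/-- If the support misses an axis, there is a bridge far out over that axis. -/
theorem exists_bridge_of_axis_disjoint (hA : IsolatedSupport A) {i j k : Fin 3} (hij : i ≠ j)
    (hik : i ≠ k) (hjk : j ≠ k) (hno : ∀ ν ∈ A, ν k = 0 → 0 < ν j) {P₀ : Fin 3 → ℕ}
    (hP₀ : P₀ ∈ A) (hP₀j : P₀ j = 0) (hP₀k : P₀ k = 1) : ∃ P Q s, IsBridge A j k P Q s := by
  -- `P` is lowest in its row next to the axis, `Q` is lexicographically lowest in `x_k = 0` for
  -- `(x_j, x_i)`.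
  obtain ⟨P, ⟨hP, hPj, hPk⟩, hPmin⟩ := exists_forall_nat_le (fun ν => ν i)
    (s := {ν | ν ∈ A ∧ ν j = 0 ∧ ν k = 1}) ⟨P₀, hP₀, hP₀j, hP₀k⟩
  obtain ⟨Q₀, ⟨hQ₀, hQ₀k⟩, hQ₀min⟩ := exists_forall_nat_le (fun ν => ν j)
    (s := {ν | ν ∈ A ∧ ν k = 0}) (hA.meets_plane k)
  obtain ⟨Q, ⟨hQ, hQk, hQj⟩, hQmin⟩ := exists_forall_nat_le (fun ν => ν i)
    (s := {ν | ν ∈ A ∧ ν k = 0 ∧ ν j = Q₀ j}) ⟨Q₀, hQ₀, hQ₀k, rfl⟩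
  have hQjpos := hno Q hQ hQk
  have hd : (1 : ℝ) ≤ Q j := by exact_mod_cast hQjpos
  set c : ℝ := (P i : ℝ)
  set e : ℝ := (Q i : ℝ)
  have hc : 0 ≤ c := Nat.cast_nonneg _
  have he : 0 ≤ e := Nat.cast_nonneg _
  -- Large enough that an extra unit of `x_j` outweighs `c` and `e`, and that `u k > c`, which rules
  -- out `x_k ≥ 2`. The `k`-th weight below is then forced by equating the weights of `P` and `Q`.
  set t : ℝ := e + 2 * c + 1 with ht
  have htpos : 0 < t := by positivity
  obtain ⟨u, hui, huj, huk⟩ := exists_vector hij hik hjk 1 t (Q j * t + e - c)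
  have hukc : c < u k := by
    rw [huk]
    nlinarith [mul_le_mul_of_nonneg_right hd htpos.le]
  have hpos : ∀ l, 0 < u l :=
    forall_distinct hij hik hjk (by rw [hui]; norm_num) (by rw [huj]; exact htpos) (by linarith)
  have hwt : ∀ ν, weight u ν = ν i + t * ν j + u k * ν k := fun ν => by
    rw [weight_distinct hij hik hjk, hui, huj]; ring
  have hwP : weight u P = c + u k := by rw [hwt, hPj, hPk]; push_cast; ring
  have hwQ : weight u Q = c + u k := by rw [hwt, hQk, huk]; push_cast; ring
  have key : ∀ ν ∈ A, c + u k ≤ weight u ν ∧ (weight u ν = c + u k → ν = P ∨ ν = Q) := by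
    intro ν hν
    rw [hwt]
    have hνi : (0 : ℝ) ≤ ν i := Nat.cast_nonneg _
    have hνj : (0 : ℝ) ≤ ν j := Nat.cast_nonneg _
    have hcase : ν k = 0 ∨ (ν k = 1 ∧ ν j = 0) ∨ (ν k = 1 ∧ 1 ≤ ν j) ∨ 2 ≤ ν k := by omega
    rcases hcase with h | ⟨h, h'⟩ | ⟨h, h'⟩ | h
    · have h1 : Q j ≤ ν j := by rw [hQj]; exact hQ₀min ν ⟨hν, h⟩
      rw [h, huk]
      rcases h1.eq_or_lt with h2 | h2
      · have h3 : Q i ≤ ν i := hQmin ν ⟨hν, h, by rw [← h2, hQj]⟩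
        have h4 : e ≤ ν i := by simp only [e]; exact_mod_cast h3
        rw [← h2]
        refine ⟨by push_cast; linarith, fun h5 => Or.inr ?_⟩
        have h6 : (ν i : ℝ) = Q i := by push_cast at h5; linarith
        exact ext_distinct hij hik hjk (by exact_mod_cast h6) h2.symm (by rw [h, hQk])
      · have h3 : (Q j : ℝ) + 1 ≤ ν j := by exact_mod_cast h2
        have h4 := mul_le_mul_of_nonneg_left h3 htpos.le
        exact ⟨by push_cast; linarith, fun h5 => by push_cast at h5; linarith⟩
    · have h3 : P i ≤ ν i := hPmin ν ⟨hν, h', h⟩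
      have h4 : c ≤ ν i := by simp only [c]; exact_mod_cast h3
      rw [h, h']
      refine ⟨by push_cast; linarith, fun h5 => Or.inl ?_⟩
      have h6 : (ν i : ℝ) = P i := by push_cast at h5; linarith
      exact ext_distinct hij hik hjk (by exact_mod_cast h6) (by rw [h', hPj]) (by rw [h, hPk])
    · have h3 : (1 : ℝ) ≤ ν j := by exact_mod_cast h'
      have h4 := mul_le_mul_of_nonneg_left h3 htpos.le
      rw [h]
      exact ⟨by push_cast; linarith, fun h5 => by push_cast at h5; linarith⟩
    · have h3 : (2 : ℝ) ≤ ν k := by exact_mod_cast h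
      have h4 := mul_le_mul_of_nonneg_left h3 (hpos k).le
      have h5 := mul_nonneg htpos.le hνj
      exact ⟨by linarith, fun h6 => by linarith⟩
  have hPm : P ∈ minSet A u := ⟨hP, fun ν hν => by rw [hwP]; exact (key ν hν).1⟩
  refine ⟨P, Q, u, hpos, hPm, mem_minSet_of_weight_le hPm hQ (by rw [hwP, hwQ]), fun ν hν => ?_,
    hPj, by omega, hQk, hQjpos, Or.inl hPk⟩
  rcases (key ν hν.1).2 ((weight_eq_of_mem_minSet hν hPm).trans hwP) with rfl | rfl
  · exact onLine_left
  · exact onLine_right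

/-- An edge from a point `W` of the axis `OX_i` to `V` can be followed, decreasing the `k`-th
weight, to a full face, unless `V j = 1` and `V i = 0`. -/
theorem full_of_axis_edge (hA : IsolatedSupport A) {i j k : Fin 3} (hij : i ≠ j)
    (hik : i ≠ k) (hjk : j ≠ k) {W V : Fin 3 → ℕ} {s w : Fin 3 → ℝ} (hs : ∀ l, 0 < s l)
    (hW : W ∈ minSet A s) (hV : V ∈ minSet A s) (hWj : W j = 0) (hWk : W k = 0) (hWi : 2 ≤ W i)
    (hVj : 0 < V j) (hwi : w i = 0) (hwj : w j = V k) (hwk : w k = -(V j : ℝ)) :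
    (∃ t : ℝ, 0 ≤ t ∧ (∀ l, 0 < s l + t * w l) ∧ W ∈ minSet A (fun l => s l + t * w l) ∧
      V ∈ minSet A (fun l => s l + t * w l) ∧ Full A (fun l => s l + t * w l)) ∨
    (V j = 1 ∧ V i = 0) := by
  have hwW : weight w W = 0 := by
    rw [weight_distinct hij hik hjk, hwi, hWj, hWk]; simp
  have hwV : weight w V = 0 := by
    rw [weight_distinct hij hik hjk, hwi, hwj, hwk]; ring
  have hVW : W ≠ V := by rintro rfl; omega
  have hWV := weight_eq_of_mem_minSet hW hV
  rcases minSet_advance hs hW w with ⟨t, ht, hpos, hWm, ν, hν, hlt⟩ | hall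
  · left
    have hVm := mem_minSet_of_weight_le hWm hV.1 (by
      rw [weight_add_mul, weight_add_mul, hwW, hwV, hWV])
    exact ⟨t, ht, hpos, hWm, hVm, full_of_weight_ne hWm hVm hVW hν (hwW.trans hwV.symm) hlt.ne⟩
  · right
    have hVj' : (0 : ℝ) < V j := by exact_mod_cast hVj
    have hVk' : (0 : ℝ) ≤ V k := Nat.cast_nonneg _
    set T := s k / V j with hTdef
    have hT : 0 < T := div_pos (hs k) hVj'
    have e1 : T * V j = s k := div_mul_cancel₀ _ hVj'.ne'
    -- At time `T` the `k`-th weight vanishes, so a monomial near `OX_k` weighs at most `s i` or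
    -- `y`. As `W i ≥ 2`, it must weigh `y`, and comparison with `W` and `V` pins down `V j` and `V
    -- i`.
    obtain ⟨ν, hν, hν1⟩ := hA.near_axis k i j hik.symm hjk.symm hij
    have hle := weight_le_of_forall_lt hT (fun t ht htT => hall t ht
      (forall_distinct hij hik hjk (by rw [hwi]; linarith [hs i])
        (by rw [hwj]; linarith [hs j, mul_nonneg ht hVk'])
        (by rw [hwk]; linarith [mul_lt_mul_of_pos_right htT hVj']))) hν
    rw [hwW] at hle
    simp only [weight_distinct hij hik hjk, hwi, hwj, hwk, hWj, hWk, ← e1] at hle hWV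
    have hσ := hs i
    have hm : (2 : ℝ) ≤ W i := by exact_mod_cast hWi
    have hm' := mul_le_mul_of_nonneg_left hm hσ.le
    have hνc : (ν i = 0 ∧ ν j = 0) ∨ (ν i = 1 ∧ ν j = 0) ∨ (ν i = 0 ∧ ν j = 1) := by omega
    rcases hνc with ⟨h1, h2⟩ | ⟨h1, h2⟩ | ⟨h1, h2⟩ <;> rw [h1, h2] at hle <;> push_cast at hle hWV
    · linarith
    · linarith
    · set y := s j + T * V k with hy
      have hle' : s i * W i ≤ y := by linarith
      have hWV' : s i * W i = s i * V i + y * V j := by rw [hy]; linarith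
      have hypos : 0 < y := by linarith
      have hVi0 : (0 : ℝ) ≤ V i := Nat.cast_nonneg _
      have h3 := mul_nonneg hσ.le hVi0
      constructor
      · by_contra h
        have h4 : (2 : ℝ) ≤ V j := by exact_mod_cast (by omega : 2 ≤ V j)
        linarith [mul_le_mul_of_nonneg_left h4 hypos.le]
      · by_contra h
        have h4 : (1 : ℝ) ≤ V i := by exact_mod_cast Nat.one_le_iff_ne_zero.mpr h
        have h5 : (1 : ℝ) ≤ V j := by exact_mod_cast hVj
        linarith [mul_le_mul_of_nonneg_left h4 hσ.le, mul_le_mul_of_nonneg_left h5 hypos.le]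

/-- An exceptional face containing a point of the axis leads to an unexceptional one touching the
axis. -/
theorem exists_touches_of_exceptional (hA : IsolatedSupport A) {v₀ : Fin 3 → ℝ}
    (hv₀ : ∀ l, 0 < v₀ l) (hfull₀ : Full A v₀) (hexc₀ : ¬ Exc A v₀) {i j k : Fin 3} (hij : i ≠ j)
    (hik : i ≠ k) (hjk : j ≠ k) {W R : Fin 3 → ℕ} {v : Fin 3 → ℝ} (hv : ∀ l, 0 < v l)
    (hfull : Full A v) (hW : W ∈ minSet A v) (hWj : W j = 0) (hWk : W k = 0) (hWi : 2 ≤ W i)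
    (hR : R ∈ minSet A v) (hRk : R k = 1) (hRij : R i = 0 ∨ R j = 0)
    (hap : ∀ ν ∈ minSet A v, ν ≠ R → ν k = 0) :
    ∃ u, (∀ l, 0 < u l) ∧ Full A u ∧ ¬ Exc A u ∧ Touches A i u := by
  have haxis : ∀ {u : Fin 3 → ℝ}, (∀ l, 0 < u l) → W ∈ minSet A u → ∀ ν ∈ minSet A u, ν j = 0 →
      ν k = 0 → ν = W := by
    intro u hu hWu ν hν h1 h2
    have h3 := weight_eq_of_mem_minSet hν hWu
    rw [weight_distinct hij hik hjk, weight_distinct hij hik hjk, h1, h2, hWj, hWk] at h3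
    have h4 : (ν i : ℝ) = W i := mul_left_cancel₀ (hu i).ne' (by linarith)
    exact ext_distinct hij hik hjk (by exact_mod_cast h4) (by rw [h1, hWj]) (by rw [h2, hWk])
  -- If the apex lies in the other plane through the axis, the face itself contains a bridge.
  -- Otherwise the face is left across its edge `WR`.
  by_cases hRj : R j = 0
  · obtain ⟨Y, hY, hYn⟩ := hfull.exists_not_onLine W R
    have hYk := hap Y hY (by rintro rfl; exact hYn onLine_right)
    have hYj : 0 < Y j := by
      by_contra h
      have := haxis hv hW Y hY (by omega) hYk
      exact hYn (this ▸ onLine_left)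
    obtain ⟨Z, s, hb, -⟩ := exists_bridge_of_apex hij hik hjk hv hR hRj hRk hap hY hYj
    exact exists_touches_of_isBridge hA hv₀ hfull₀ hexc₀ hij hik hjk hb
  have hRi : R i = 0 := by omega
  obtain ⟨w, hwi, hwj, hwk⟩ := exists_vector hij hik hjk 0 (R k : ℝ) (-(R j : ℝ))
  have hwW : weight w W = 0 := by
    rw [weight_distinct hij hik hjk, hwi, hWj, hWk]; simp
  have hwR : weight w R = 0 := by
    rw [weight_distinct hij hik hjk, hwi, hwj, hwk]; ring
  have hwν : ∀ ν : Fin 3 → ℕ, ν k = 0 → weight w ν = ν j := fun ν h => by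
    rw [weight_distinct hij hik hjk, hwi, hwj, h, hRk]; simp
  obtain ⟨ε, hε, hpos, hmem⟩ := minSet_perturb hv hW w fun ν hν => by
    rw [hwW]
    by_cases h : ν = R
    · rw [h, hwR]
    · rw [hwν ν (hap ν hν h)]; exact Nat.cast_nonneg _
  set s := fun l => v l + ε * w l with hsdef
  have hWs : W ∈ minSet A s := (hmem W).mpr ⟨hW, rfl⟩
  have hRs : R ∈ minSet A s := (hmem R).mpr ⟨hR, by rw [hwR, hwW]⟩
  by_cases hRj1 : R j = 1
  · refine absurd (exc_of_edge hij hik hjk hpos hRs hWs hRi hRj1 hRk hWj hWk (fun ν hν => ?_) hv₀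
      hfull₀) hexc₀
    obtain ⟨h1, h2⟩ := (hmem ν).mp hν
    by_cases h : ν = R
    · rw [h, hRj1, hRk]
    · have h3 := hap ν h1 h
      rw [hwν ν h3, hwW] at h2
      rw [h3]; exact_mod_cast h2
  rcases full_of_axis_edge hA hij hik hjk hpos hWs hRs hWj hWk hWi (by omega) hwi hwj hwk with
    ⟨t, ht, hpos', hW', hR', hfull'⟩ | ⟨h, -⟩
  · refine ⟨_, hpos', hfull', ?_, Or.inl ⟨W, hW', forall_distinct hij hik hjk (fun h => absurd rfl h)
      (fun _ => hWj) (fun _ => hWk)⟩⟩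
    -- Now `W i` and `R j` are at least two, so an exceptional neighbour would again have base in
    -- `x_k = 0` and apex `R`. But the tilt raised the weight of base points with `x_j > 0` above
    -- that of `W`.
    rintro ⟨j', k', -, R', hRm, hRj', -, hap'⟩
    have hj' : j' = i ∨ j' = j ∨ j' = k :=
      forall_distinct hij hik hjk (p := fun l => l = i ∨ l = j ∨ l = k) (by simp) (by simp)
        (by simp) j'
    rcases hj' with rfl | rfl | rfl
    · by_cases h : W = R'
      · rw [← h] at hRj'; omega
      · have := hap' W hW' h; omega
    · by_cases h : R = R'
      · rw [← h] at hRj'; omega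
      · have := hap' R hR' h; omega
    · by_cases h : R = R'
      · subst h
        obtain ⟨Y, hY, hYn⟩ := hfull'.exists_not_onLine W R
        have hYk := hap' Y hY (by rintro rfl; exact hYn onLine_right)
        have hYj : 0 < Y j := by
          by_contra h
          have := haxis hpos' hW' Y hY (by omega) hYk
          exact hYn (this ▸ onLine_left)
        have h1 := weight_eq_of_mem_minSet hY hW'
        have h2 := hW.2 Y hY.1
        have e : ∀ ν, weight (fun l => v l + ε * w l + t * w l) ν =
            weight v ν + ε * weight w ν + t * weight w ν := fun ν => by
          rw [weight_add_mul (fun l => v l + ε * w l), weight_add_mul]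
        have h1 := (e Y).symm.trans (h1.trans (e W))
        rw [hwW, hwν Y hYk] at h1
        have h3 : (0 : ℝ) < Y j := by exact_mod_cast hYj
        linarith [mul_pos hε h3, mul_nonneg ht h3.le]
      · have := hap' R hR' h; omega
  · exact absurd h hRj1

theorem exists_touches (hA : IsolatedSupport A) {v₀ : Fin 3 → ℝ}
    (hv₀ : ∀ l, 0 < v₀ l) (hfull₀ : Full A v₀) (hexc₀ : ¬ Exc A v₀) (i : Fin 3) :
    ∃ u, (∀ l, 0 < u l) ∧ Full A u ∧ ¬ Exc A u ∧ Touches A i u := by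
  obtain ⟨j, k, hij, hik, hjk⟩ := exists_others i
  by_cases hax : ∃ W ∈ A, W j = 0 ∧ W k = 0
  · obtain ⟨W, ⟨hWA, hWj, hWk⟩, hWmin⟩ := exists_forall_nat_le (fun ν => ν i)
      (s := {ν | ν ∈ A ∧ ν j = 0 ∧ ν k = 0}) hax
    have hWi := hA.two_le hij hik hjk hWA
    rw [hWj, hWk] at hWi
    replace hWi : 2 ≤ W i := by omega
    have hm : (2 : ℝ) ≤ W i := by exact_mod_cast hWi
    obtain ⟨v, hv, hfull, hW⟩ : ∃ v : Fin 3 → ℝ, (∀ l, 0 < v l) ∧ Full A v ∧ W ∈ minSet A v := by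
      -- Off the axis a single unit of `x_j` or `x_k` already weighs as much as `W`.
      obtain ⟨u, hui, huj, huk⟩ := exists_vector hij hik hjk 1 (W i : ℝ) (W i : ℝ)
      have hu : ∀ l, 0 < u l := forall_distinct hij hik hjk (by rw [hui]; norm_num)
        (by rw [huj]; linarith) (by rw [huk]; linarith)
      have hwt : ∀ ν, weight u ν = ν i + W i * ν j + W i * ν k := fun ν => by
        rw [weight_distinct hij hik hjk, hui, huj, huk]; ring
      have hWu : W ∈ minSet A u := by
        refine ⟨hWA, fun ν hν => ?_⟩
        rw [hwt, hwt, hWj, hWk]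
        have hle : W i ≤ ν i + W i * ν j + W i * ν k := by
          rcases Nat.eq_zero_or_pos (ν j) with h1 | h1
          · rcases Nat.eq_zero_or_pos (ν k) with h2 | h2
            · have := hWmin ν ⟨hν, h1, h2⟩
              omega
            · have := Nat.le_mul_of_pos_right (W i) h2
              omega
          · have := Nat.le_mul_of_pos_right (W i) h1
            omega
        have : (W i : ℝ) ≤ ν i + W i * ν j + W i * ν k := by exact_mod_cast hle
        simpa using this
      obtain ⟨w, hwi, hwj, hwk⟩ := exists_vector hij hik hjk 0 (-1) (-1)
      have hw : ∀ ν, weight w ν = -(ν j + ν k : ℝ) := fun ν => by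
        rw [weight_distinct hij hik hjk, hwi, hwj, hwk]; ring
      rcases minSet_advance hu hWu w with ⟨t, ht, hpos, hWm, V, hV, hlt⟩ | hall
      -- If the minimal set is only an edge `WV`, it can be rotated in either direction; failure of
      -- all available rotations forces `V = e_j + e_k`, excluded by `exc_of_edge`.
      · by_contra! hcon
        have hnf : ¬ Full A (fun l => u l + t * w l) := fun h => hcon _ hpos h hWm
        have hV0 : 0 < V j + V k := by
          rw [hw, hw, hWj, hWk] at hlt
          have : (0 : ℝ) < V j + V k := by push_cast at hlt; linarith
          exact_mod_cast this
        have h2V := hA.two_le hij hik hjk hV.1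
        have hj : 0 < V j → V j = 1 ∧ V i = 0 := fun h => by
          obtain ⟨w', h1, h2, h3⟩ := exists_vector hij hik hjk 0 (V k : ℝ) (-(V j : ℝ))
          rcases full_of_axis_edge hA hij hik hjk hpos hWm hV hWj hWk hWi h h1 h2 h3 with
            ⟨t, -, h1, h2, -, h3⟩ | h
          · exact absurd h2 (hcon _ h1 h3)
          · exact h
        have hk : 0 < V k → V k = 1 ∧ V i = 0 := fun h => by
          obtain ⟨w', h1, h2, h3⟩ := exists_vector hik hij hjk.symm 0 (V j : ℝ) (-(V k : ℝ))
          rcases full_of_axis_edge hA hik hij hjk.symm hpos hWm hV hWk hWj hWi h h1 h2 h3 with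
            ⟨t, -, h1, h2, -, h3⟩ | h
          · exact absurd h2 (hcon _ h1 h3)
          · exact h
        have hV1 : V i = 0 ∧ V j = 1 ∧ V k = 1 := by omega
        have hVW : W ≠ V := by rintro rfl; omega
        refine hexc₀ (exc_of_edge hij hik hjk hpos hV hWm hV1.1 hV1.2.1 hV1.2.2 hWj hWk
          (fun ν hν => ?_) hv₀ hfull₀)
        obtain ⟨r, hr⟩ := onLine_of_not_full hnf hWm hV hVW hν
        have h3 := hr j
        have h4 := hr k
        rw [hWj, hV1.2.1] at h3
        rw [hWk, hV1.2.2] at h4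
        have : (ν j : ℝ) = ν k := by rw [h3, h4]
        exact_mod_cast this
      · exfalso
        -- Otherwise `W` stays minimal down to the weight `(1, 0, 0)`, where a monomial in `x_i = 0`
        -- beats it.
        obtain ⟨ν, hν, hνi⟩ := hA.meets_plane i
        have := weight_le_of_forall_lt (T := W i) (by linarith) (fun t ht htT => hall t ht
          (forall_distinct hij hik hjk (by rw [hui, hwi]; norm_num)
            (by rw [huj, hwj]; linarith) (by rw [huk, hwk]; linarith))) hν
        rw [hwt, hwt, hw, hw, hWj, hWk, hνi] at this
        push_cast at this
        linarith
    by_cases hexc : Exc A v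
    · obtain ⟨j', k', hjk', R, hR, hRj, hRk, hap⟩ := hexc
      have hj' : j' = i ∨ j' = j ∨ j' = k :=
        forall_distinct hij hik hjk (p := fun l => l = i ∨ l = j ∨ l = k) (by simp) (by simp)
          (by simp) j'
      have hk' : k' = i ∨ k' = j ∨ k' = k :=
        forall_distinct hij hik hjk (p := fun l => l = i ∨ l = j ∨ l = k) (by simp) (by simp)
          (by simp) k'
      rcases hj' with rfl | rfl | rfl
      · exfalso
        by_cases h : W = R
        · rw [← h] at hRj; omega
        · have := hap W hW h; omega
      · refine exists_touches_of_exceptional hA hv₀ hfull₀ hexc₀ hik hij hjk.symm hv hfull hW hWk hWj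
          hWi hR hRj ?_ hap
        rcases hk' with rfl | rfl | rfl
        · exact Or.inl hRk
        · exact absurd rfl hjk'
        · exact Or.inr hRk
      · refine exists_touches_of_exceptional hA hv₀ hfull₀ hexc₀ hij hik hjk hv hfull hW hWj hWk
          hWi hR hRj ?_ hap
        rcases hk' with rfl | rfl | rfl
        · exact Or.inl hRk
        · exact Or.inr hRk
        · exact absurd rfl hjk'
    · exact ⟨v, hv, hfull, hexc, Or.inl ⟨W, hW, forall_distinct hij hik hjk
        (fun h => absurd rfl h) (fun _ => hWj) (fun _ => hWk)⟩⟩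
  · push Not at hax
    obtain ⟨P, hP, hP1⟩ := hA.near_axis i j k hij hik hjk
    have hPc : (P j = 0 ∧ P k = 1) ∨ (P j = 1 ∧ P k = 0) := by
      have := hax P hP
      omega
    rcases hPc with ⟨h1, h2⟩ | ⟨h1, h2⟩
    · obtain ⟨P, Q, s, hb⟩ := exists_bridge_of_axis_disjoint hA hij hik hjk
        (fun ν hν h => Nat.pos_of_ne_zero fun h' => hax ν hν h' h) hP h1 h2
      exact exists_touches_of_isBridge hA hv₀ hfull₀ hexc₀ hij hik hjk hb
    · obtain ⟨P, Q, s, hb⟩ := exists_bridge_of_axis_disjoint hA hik hij hjk.symm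
        (fun ν hν h => Nat.pos_of_ne_zero fun h' => hax ν hν h h') hP h2 h1
      exact exists_touches_of_isBridge hA hv₀ hfull₀ hexc₀ hik hij hjk.symm hb

end Touching

/-! ### Exposed faces of convex hulls -/

section ConvexFaces

/-- The points of a convex hull at which a linear functional attains its lower bound form the
convex hull of the generators at which it does. -/
theorem convexHull_inter_level {E : Type*} [AddCommGroup E] [Module ℝ E] (ℓ : E →ₗ[ℝ] ℝ)
    {s : Set E} {c : ℝ} (h : ∀ x ∈ s, c ≤ ℓ x) :
    {x | x ∈ convexHull ℝ s ∧ ℓ x = c} = convexHull ℝ {x | x ∈ s ∧ ℓ x = c} := by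
  apply Subset.antisymm
  · have hconv : Convex ℝ {x | c ≤ ℓ x ∧ (ℓ x = c → x ∈ convexHull ℝ {x | x ∈ s ∧ ℓ x = c})} := by
      intro x hx y hy a b ha hb hab
      have hval : ℓ (a • x + b • y) = a * ℓ x + b * ℓ y := by simp
      have h1 := mul_le_mul_of_nonneg_left hx.1 ha
      have h2 := mul_le_mul_of_nonneg_left hy.1 hb
      have h3 : a * c + b * c = c := by rw [← add_mul, hab, one_mul]
      refine ⟨by rw [hval]; linarith, fun heq => ?_⟩
      rw [hval] at heq
      rcases ha.eq_or_lt with rfl | ha'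
      · have hb1 : b = 1 := by linarith
        subst hb1
        simpa using hy.2 (by linarith)
      rcases hb.eq_or_lt with rfl | hb'
      · have ha1 : a = 1 := by linarith
        subst ha1
        simpa using hx.2 (by linarith)
      refine convex_convexHull ℝ _ (hx.2 ?_) (hy.2 ?_) ha hb hab
      · exact mul_left_cancel₀ ha'.ne' (by linarith)
      · exact mul_left_cancel₀ hb'.ne' (by linarith)
    have hsub : convexHull ℝ s ⊆ _ := convexHull_min
      (show s ⊆ {x | c ≤ ℓ x ∧ (ℓ x = c → x ∈ convexHull ℝ {x | x ∈ s ∧ ℓ x = c})} from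
        fun x hx => ⟨h x hx, fun hc => subset_convexHull ℝ _ ⟨hx, hc⟩⟩) hconv
    exact fun x hx => (hsub hx.1).2 hx.2
  · refine convexHull_min (fun x hx => ⟨subset_convexHull ℝ _ hx.1, hx.2⟩) ?_
    exact (convex_convexHull ℝ s).inter (convex_hyperplane ℓ.isLinear c)

theorem le_of_mem_convexHull {E : Type*} [AddCommGroup E] [Module ℝ E] (ℓ : E →ₗ[ℝ] ℝ)
    {s : Set E} {c : ℝ} (h : ∀ x ∈ s, c ≤ ℓ x) {x : E} (hx : x ∈ convexHull ℝ s) : c ≤ ℓ x :=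
  convexHull_min h (convex_halfSpace_ge ℓ.isLinear c) hx

theorem isExposed_convexHull {E : Type*} [AddCommGroup E] [Module ℝ E] [TopologicalSpace E]
    [IsTopologicalAddGroup E]
    (ℓ : E →L[ℝ] ℝ) {s : Set E} {c : ℝ} (h : ∀ x ∈ s, c ≤ ℓ x) :
    IsExposed ℝ (convexHull ℝ s) (convexHull ℝ {x | x ∈ s ∧ ℓ x = c}) := by
  rintro ⟨y, hy⟩
  refine ⟨-ℓ, ?_⟩
  have hlev := convexHull_inter_level (ℓ : E →ₗ[ℝ] ℝ) h
  simp only [ContinuousLinearMap.coe_coe] at hlev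
  rw [← hlev] at hy ⊢
  ext x
  constructor
  · rintro ⟨hx, hxc⟩
    refine ⟨hx, fun z hz => ?_⟩
    have := le_of_mem_convexHull (ℓ : E →ₗ[ℝ] ℝ) h hz
    simp only [ContinuousLinearMap.coe_coe] at this
    simp only [neg_apply, hxc]
    linarith
  · rintro ⟨hx, hmin⟩
    refine ⟨hx, le_antisymm ?_ (le_of_mem_convexHull (ℓ : E →ₗ[ℝ] ℝ) h hx)⟩
    have := hmin y hy.1
    simp only [neg_apply, hy.2] at this
    linarith

theorem mem_extremePoints_convexHull {E : Type*} [AddCommGroup E] [Module ℝ E]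
    [TopologicalSpace E] [IsTopologicalAddGroup E]
    (ℓ : E →L[ℝ] ℝ) {s : Set E} {p : E} (hp : p ∈ s)
    (h : ∀ x ∈ s, x ≠ p → ℓ p < ℓ x) : p ∈ (convexHull ℝ s).extremePoints ℝ := by
  rw [← isExtreme_singleton]
  have hle : ∀ x ∈ s, ℓ p ≤ ℓ x := fun x hx => by
    by_cases hxp : x = p
    · rw [hxp]
    · exact (h x hx hxp).le
  have heq : {x | x ∈ s ∧ ℓ x = ℓ p} = {p} := by
    ext x
    refine ⟨fun hx => ?_, fun hx => by rw [mem_singleton_iff.mp hx]; exact ⟨hp, rfl⟩⟩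
    by_contra hxp
    exact (h x hx.1 hxp).ne' hx.2
  have := (isExposed_convexHull ℓ hle).isExtreme
  rwa [heq, convexHull_singleton] at this

end ConvexFaces

/-! ### Compact faces of the Newton polyhedron as hulls of lattice points -/

section Faces

variable {n : ℕ} {A : Set (Fin n → ℕ)}

/-- The Newton polyhedron of a set of lattice points. -/
def polyhedron (A : Set (Fin n → ℕ)) : Set (EuclideanSpace ℝ (Fin n)) :=
  convexHull ℝ {x | ∃ ν : Fin n → ℕ, ν ∈ A ∧ ∀ i, (ν i : ℝ) ≤ x i}

/-- The convex hull of the points of least weight. -/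
def face (A : Set (Fin n → ℕ)) (u : Fin n → ℝ) : Set (EuclideanSpace ℝ (Fin n)) :=
  convexHull ℝ (latticePoint '' minSet A u)

theorem inner_eq_sum (u x : EuclideanSpace ℝ (Fin n)) : inner ℝ u x = ∑ l, u l * x l := by
  simp [PiLp.inner_apply, mul_comm]

theorem inner_latticePoint (u : EuclideanSpace ℝ (Fin n)) (ν : Fin n → ℕ) :
    inner ℝ u (latticePoint ν) = weight u ν := inner_eq_sum _ _

theorem supportSet_eq_face (hA : A.Nonempty) {u : EuclideanSpace ℝ (Fin n)} (hu : ∀ l, 0 < u l) :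
    supportSet u (polyhedron A) = face A u := by
  obtain ⟨P, hP⟩ := minSet_nonempty (u := u) (fun l => (hu l).le) hA
  have hge : ∀ (x : EuclideanSpace ℝ (Fin n)) (ν : Fin n → ℕ), (∀ i, (ν i : ℝ) ≤ x i) →
      weight u ν ≤ inner ℝ u x := fun x ν h => by
    rw [inner_eq_sum]
    exact Finset.sum_le_sum fun l _ => mul_le_mul_of_nonneg_left (h l) (hu l).le
  set ℓ : EuclideanSpace ℝ (Fin n) →ₗ[ℝ] ℝ := (innerSL ℝ u).toLinearMap with hℓ
  have hℓa : ∀ x, ℓ x = inner ℝ u x := fun x => by simp [hℓ]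
  have hbound : ∀ x ∈ {x : EuclideanSpace ℝ (Fin n) | ∃ ν : Fin n → ℕ, ν ∈ A ∧
      ∀ i, (ν i : ℝ) ≤ x i}, weight u P ≤ ℓ x := by
    rintro x ⟨ν, hν, hx⟩
    rw [hℓa]
    exact (hP.2 ν hν).trans (hge x ν hx)
  have hgen : {x | x ∈ {x : EuclideanSpace ℝ (Fin n) | ∃ ν : Fin n → ℕ, ν ∈ A ∧
      ∀ i, (ν i : ℝ) ≤ x i} ∧ ℓ x = weight u P} = latticePoint '' minSet A u := by
    ext x
    constructor
    · rintro ⟨⟨ν, hν, hx⟩, hxP⟩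
      rw [hℓa] at hxP
      have h1 := hge x ν hx
      refine ⟨ν, mem_minSet_of_weight_le hP hν (by linarith), ?_⟩
      by_contra hne
      obtain ⟨l, hl⟩ : ∃ l, (ν l : ℝ) ≠ x l := by
        by_contra! h
        exact hne (by ext l; exact h l)
      have : weight u ν < inner ℝ u x := by
        rw [inner_eq_sum]
        exact Finset.sum_lt_sum (fun l _ => mul_le_mul_of_nonneg_left (hx l) (hu l).le)
          ⟨l, Finset.mem_univ l, mul_lt_mul_of_pos_left (lt_of_le_of_ne (hx l) hl) (hu l)⟩
      linarith [hP.2 ν hν]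
    · rintro ⟨ν, hν, rfl⟩
      refine ⟨⟨ν, hν.1, fun l => le_rfl⟩, ?_⟩
      rw [hℓa, inner_latticePoint, weight_eq_of_mem_minSet hν hP]
  have hlev := convexHull_inter_level ℓ hbound
  rw [hgen] at hlev
  rw [face, ← hlev]
  have hPmem : latticePoint P ∈ polyhedron A := subset_convexHull ℝ _ ⟨P, hP.1, fun l => le_rfl⟩
  ext x
  constructor
  · rintro ⟨hx, hmin⟩
    refine ⟨hx, le_antisymm ?_ (le_of_mem_convexHull ℓ hbound hx)⟩
    rw [hℓa, ← inner_latticePoint]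
    exact hmin _ hPmem
  · rintro ⟨hx, hxP⟩
    refine ⟨hx, fun y hy => ?_⟩
    rw [← hℓa, hxP, ← hℓa]
    exact le_of_mem_convexHull ℓ hbound hy

theorem add_single_mem_polyhedron {x : EuclideanSpace ℝ (Fin n)} (hx : x ∈ polyhedron A)
    (l : Fin n) {t : ℝ} (ht : 0 ≤ t) : x + EuclideanSpace.single l t ∈ polyhedron A := by
  have hconv : Convex ℝ {y | y + EuclideanSpace.single l t ∈ polyhedron A} :=
    (convex_convexHull ℝ _).translate_preimage_left _
  refine convexHull_min ?_ hconv hx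
  rintro y ⟨ν, hν, hy⟩
  refine subset_convexHull ℝ _ ⟨ν, hν, fun i => (hy i).trans ?_⟩
  rw [PiLp.add_apply, le_add_iff_nonneg_right, PiLp.single_apply]
  split_ifs
  · exact ht
  · exact le_rfl

/-- The polyhedron recedes in every coordinate direction; a zero weight would let the face recede
with it. -/
theorem pos_of_isCompact_supportSet {u : EuclideanSpace ℝ (Fin n)} (hu : ∀ l, 0 ≤ u l)
    (hne : (supportSet u (polyhedron A)).Nonempty)
    (hc : IsCompact (supportSet u (polyhedron A))) (l : Fin n) : 0 < u l := by
  refine lt_of_le_of_ne (hu l) fun h0 => ?_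
  obtain ⟨x, hx, hmin⟩ := hne
  obtain ⟨C, hC⟩ := hc.isBounded.exists_norm_le
  have hmem : ∀ t : ℝ, 0 ≤ t → x + EuclideanSpace.single l t ∈ supportSet u (polyhedron A) := by
    refine fun t ht => ⟨add_single_mem_polyhedron hx l ht, fun w hw => ?_⟩
    have : inner ℝ u (EuclideanSpace.single l t) = (0 : ℝ) := by
      rw [inner_eq_sum]
      refine Finset.sum_eq_zero fun i _ => ?_
      rw [PiLp.single_apply]
      split_ifs with h
      · rw [h, ← h0, zero_mul]
      · rw [mul_zero]
    rw [inner_add_right, this, add_zero]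
    exact hmin w hw
  have h1 := hC _ (hmem (|C| + |x l| + 1) (by positivity))
  have h2 := PiLp.norm_apply_le (x + EuclideanSpace.single l (|C| + |x l| + 1)) l
  rw [PiLp.add_apply, PiLp.single_apply, if_pos rfl, Real.norm_eq_abs] at h2
  have h3 := le_abs_self (x l + (|C| + |x l| + 1))
  linarith [neg_abs_le (x l), le_abs_self C]

theorem vectorSpan_convexHull (V : Set (EuclideanSpace ℝ (Fin n))) :
    vectorSpan ℝ (convexHull ℝ V) = vectorSpan ℝ V := by
  rw [← direction_affineSpan, affineSpan_convexHull, direction_affineSpan]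

theorem dim_convexHull (V : Set (EuclideanSpace ℝ (Fin n))) :
    dim (convexHull ℝ V) = Module.finrank ℝ (vectorSpan ℝ V) := by
  rw [dim, vectorSpan_convexHull]

theorem finite_vertices_face {u : Fin n → ℝ} (hu : ∀ l, 0 < u l) : (vertices (face A u)).Finite :=
  ((minSet_finite hu).image _).subset extremePoints_convexHull_subset

theorem isCompact_face {u : Fin n → ℝ} (hu : ∀ l, 0 < u l) : IsCompact (face A u) :=
  Set.Finite.isCompact_convexHull ℝ ((minSet_finite hu).image _)

theorem convexHull_vertices_face {u : Fin n → ℝ} (hu : ∀ l, 0 < u l) :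
    convexHull ℝ (vertices (face A u)) = face A u := by
  have h := closure_convexHull_extremePoints (isCompact_face (A := A) hu) (convex_convexHull ℝ _)
  rwa [IsClosed.closure_eq] at h
  exact Set.Finite.isClosed_convexHull ℝ (finite_vertices_face hu)

end Faces

/-! ### Geometric meaning of the combinatorial conditions -/

section Space

variable {A : Set (Fin 3 → ℕ)}

theorem dim_face {u : Fin 3 → ℝ} (hu : ∀ l, 0 < u l) : dim (face A u) = 2 ↔ Full A u := by
  rw [face, dim_convexHull, Full, collinear_iff_finrank_le_one]
  constructor
  · intro h; omega
  · intro h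
    refine le_antisymm ?_ (by omega)
    set U : EuclideanSpace ℝ (Fin 3) := WithLp.toLp 2 u with hU
    have hU0 : U ≠ 0 := fun h0 => by
      have : U 0 = 0 := by rw [h0]; rfl
      exact (hu 0).ne' this
    have hle : vectorSpan ℝ (latticePoint '' minSet A u) ≤ (ℝ ∙ U)ᗮ := by
      rw [vectorSpan, Submodule.span_le]
      rintro _ ⟨_, ⟨ν, hν, rfl⟩, _, ⟨μ, hμ, rfl⟩, rfl⟩
      rw [SetLike.mem_coe, Submodule.mem_orthogonal_singleton_iff_inner_right]
      simp only [vsub_eq_sub, inner_sub_right, inner_latticePoint]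
      exact sub_eq_zero.mpr (weight_eq_of_mem_minSet hν hμ)
    have : Fact (Module.finrank ℝ (EuclideanSpace ℝ (Fin 3)) = 2 + 1) := ⟨by simp⟩
    calc _ ≤ Module.finrank ℝ (ℝ ∙ U)ᗮ := Submodule.finrank_mono hle
      _ = 2 := Submodule.finrank_orthogonal_span_singleton hU0

theorem infDist_axis {i j k : Fin 3} (hij : i ≠ j) (hik : i ≠ k) (hjk : j ≠ k)
    (x : EuclideanSpace ℝ (Fin 3)) : Metric.infDist x (axis i) = √(x j ^ 2 + x k ^ 2) := by
  have hd : ∀ y ∈ axis i, dist x y = √((x i - y i) ^ 2 + x j ^ 2 + x k ^ 2) := fun y hy => by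
    rw [EuclideanSpace.dist_eq, sum_distinct hij hik hjk, hy j hij.symm, hy k hik.symm]
    simp [Real.dist_eq, sq_abs]
  have hmem : EuclideanSpace.single i (x i) ∈ axis i := fun l hl => by
    simp [hl]
  apply le_antisymm
  · refine (Metric.infDist_le_dist_of_mem hmem).trans_eq ?_
    rw [hd _ hmem]
    simp
  · refine (Metric.le_infDist ⟨_, hmem⟩).mpr fun y hy => ?_
    rw [hd y hy]
    exact Real.sqrt_le_sqrt (by nlinarith [sq_nonneg (x i - y i)])

theorem infDist_latticePoint_axis {i j k : Fin 3} (hij : i ≠ j) (hik : i ≠ k) (hjk : j ≠ k)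
    (P : Fin 3 → ℕ) : Metric.infDist (latticePoint P) (axis i) = 1 ↔
      (P j = 1 ∧ P k = 0) ∨ (P j = 0 ∧ P k = 1) := by
  rw [infDist_axis hij hik hjk, Real.sqrt_eq_one, latticePoint_apply, latticePoint_apply]
  constructor
  · intro h
    have h0 : (P j : ℝ) ^ 2 + (P k : ℝ) ^ 2 = 1 := h
    have h1 : P j ^ 2 + P k ^ 2 = 1 := by exact_mod_cast h0
    have h2 : P j ≤ 1 := by nlinarith
    have h3 : P k ≤ 1 := by nlinarith
    interval_cases P j <;> interval_cases P k <;> simp_all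
  · rintro (⟨h1, h2⟩ | ⟨h1, h2⟩) <;> rw [h1, h2] <;> norm_num

/-- The geometric definition controls vertices only, `Exc` all lattice points. Integrality bridges
the gap: on the face `x_j ≤ 1` with equality only at the apex, so every other lattice point has `x_j
= 0`. An apex inside the base plane is impossible, since the face would be flat. -/
theorem exc_of_isExceptionalWrt {u : Fin 3 → ℝ} (hu : ∀ l, 0 < u l) (hfull : Full A u)
    {i : Fin 3} (h : IsExceptionalWrt (face A u) i) : Exc A u := by
  obtain ⟨W, hW, hdist, -, -, j, hij, hsub⟩ := h
  obtain ⟨P, hP, rfl⟩ := extremePoints_convexHull_subset hW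
  have hij : j ≠ i := by
    rintro rfl
    have : (EuclideanSpace.single j (1 : ℝ)) ∈ axis j := fun l hl => by simp [hl]
    have := hij this
    simp [coordHyperplane] at this
  obtain ⟨k, hkj, hki⟩ := exists_third hij
  rw [infDist_latticePoint_axis hij.symm hki.symm hkj.symm] at hdist
  have hv : ∀ x ∈ vertices (face A u), x ≠ latticePoint P → x j = 0 := fun x hx hne =>
    hsub (subset_convexHull ℝ _ ⟨hx, hne⟩)
  have hlat : ∀ ν ∈ minSet A u, latticePoint ν ∈ convexHull ℝ (vertices (face A u)) := by
    intro ν hν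
    rw [convexHull_vertices_face hu]
    exact subset_convexHull ℝ _ ⟨ν, hν, rfl⟩
  set ℓ : EuclideanSpace ℝ (Fin 3) →ₗ[ℝ] ℝ := -(EuclideanSpace.proj (𝕜 := ℝ) j).toLinearMap
    with hℓ
  have hℓa : ∀ x, ℓ x = -(x j) := fun x => by simp [hℓ]
  have hle : ∀ {c : ℝ}, 0 ≤ c → (P j : ℝ) ≤ c → ∀ x ∈ vertices (face A u), -c ≤ ℓ x := by
    intro c hc hPc x hx
    rw [hℓa, neg_le_neg_iff]
    by_cases h : x = latticePoint P
    · rw [h]; exact hPc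
    · rw [hv x hx h]; exact hc
  rcases hdist with ⟨h1, h2⟩ | ⟨h1, h2⟩
  · refine ⟨j, k, hkj.symm, P, hP, h1, h2, fun ν hν hne => ?_⟩
    have hle1 := hle zero_le_one (by rw [h1]; norm_num)
    have h3 := le_of_mem_convexHull ℓ hle1 (hlat ν hν)
    rw [hℓa, latticePoint_apply, neg_le_neg_iff] at h3
    have h4 : ν j ≤ 1 := by exact_mod_cast h3
    by_contra h5
    have h6 : ν j = 1 := by omega
    have h7 : latticePoint ν ∈ {x | x ∈ convexHull ℝ (vertices (face A u)) ∧ ℓ x = -1} :=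
      ⟨hlat ν hν, by rw [hℓa, latticePoint_apply, h6]; norm_num⟩
    rw [convexHull_inter_level ℓ hle1] at h7
    have h8 : {x | x ∈ vertices (face A u) ∧ ℓ x = -1} ⊆ {latticePoint P} := by
      rintro x ⟨hx, hx1⟩
      by_contra hxP
      rw [hℓa, hv x hx hxP] at hx1
      norm_num at hx1
    have h9 := convexHull_mono h8 h7
    rw [convexHull_singleton] at h9
    exact hne (latticePoint_injective h9)
  · exfalso
    obtain ⟨ν, hν, hne⟩ := hfull.exists_ne_zero hu j
    have h3 := le_of_mem_convexHull ℓ (hle le_rfl (by rw [h1]; norm_num)) (hlat ν hν)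
    rw [hℓa, latticePoint_apply, neg_le_neg_iff] at h3
    have h4 : ν j ≤ 0 := by exact_mod_cast h3
    omega

theorem isExceptionalWrt_of_exc {u : Fin 3 → ℝ} (hu : ∀ l, 0 < u l) (hfull : Full A u)
    (h : Exc A u) : ∃ i, IsExceptionalWrt (face A u) i := by
  obtain ⟨j, k, hjk, P, hP, hPj, hPk, hap⟩ := h
  obtain ⟨i, hij, hik⟩ := exists_third hjk
  have hvP : latticePoint P ∈ vertices (face A u) := by
    refine mem_extremePoints_convexHull (-(EuclideanSpace.proj (𝕜 := ℝ) j)) ⟨P, hP, rfl⟩ ?_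
    rintro _ ⟨ν, hν, rfl⟩ hne
    have := hap ν hν (fun h => hne (by rw [h]))
    simp [latticePoint_apply, this, hPj]
  have hv : ∀ x ∈ vertices (face A u), x ≠ latticePoint P →
      x ∈ latticePoint '' {ν | ν ∈ minSet A u ∧ ν j = 0} := by
    intro x hx hne
    obtain ⟨ν, hν, rfl⟩ := extremePoints_convexHull_subset hx
    exact ⟨ν, ⟨hν, hap ν hν (fun h => hne (by rw [h]))⟩, rfl⟩
  have hv0 : ∀ x ∈ vertices (face A u), x ≠ latticePoint P → x j = 0 := by
    intro x hx hne
    obtain ⟨ν, ⟨-, hν⟩, rfl⟩ := hv x hx hne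
    rw [latticePoint_apply, hν, Nat.cast_zero]
  have hset : vertices (face A u) \ {latticePoint P} =
      {x | x ∈ vertices (face A u) ∧ EuclideanSpace.proj (𝕜 := ℝ) j x = 0} := by
    ext x
    refine ⟨fun hx => ⟨hx.1, hv0 x hx.1 hx.2⟩, fun hx => ⟨hx.1, ?_⟩⟩
    rintro rfl
    have := hx.2
    simp [latticePoint_apply, hPj] at this
  refine ⟨i, latticePoint P, hvP,
    (infDist_latticePoint_axis hij hik hjk P).mpr (Or.inl ⟨hPj, hPk⟩), ?_, ?_, j,
    fun x hx => hx j hij.symm, ?_⟩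
  · have := isExposed_convexHull (s := vertices (face A u)) (EuclideanSpace.proj (𝕜 := ℝ) j)
      (c := 0) ?_
    · rwa [convexHull_vertices_face hu, ← hset] at this
    · intro x hx
      obtain ⟨ν, hν, rfl⟩ := extremePoints_convexHull_subset hx
      exact Nat.cast_nonneg (ν j)
  · rw [dim_convexHull]
    -- The base is at most a line, being planar inside the face; it is at least a line, since adding
    -- one apex gains at most one dimension.
    have h1 : Module.finrank ℝ (vectorSpan ℝ (vertices (face A u) \ {latticePoint P})) ≤ 1 := by
      rw [← collinear_iff_finrank_le_one]
      exact (collinear_of_subset_plane hu (fun ν hν => hν.1) (fun ν hν => hν.2)).subset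
        (fun x hx => hv x hx.1 hx.2)
    have h2 := (dim_face hu).mpr hfull
    rw [← convexHull_vertices_face hu, dim_convexHull] at h2
    have h3 := finrank_vectorSpan_insert_le_set ℝ (vertices (face A u) \ {latticePoint P})
      (latticePoint P)
    rw [insert_sdiff_singleton, insert_eq_of_mem hvP, h2] at h3
    omega
  · refine convexHull_min (fun x hx => hv0 x hx.1 hx.2) ?_
    exact convex_hyperplane (EuclideanSpace.proj (𝕜 := ℝ) j).toLinearMap.isLinear 0

theorem mem_vertices_of_axis {u : Fin 3 → ℝ} (hu : ∀ l, 0 < u l) {i : Fin 3} {W : Fin 3 → ℕ}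
    (hW : W ∈ minSet A u) (hax : ∀ l, l ≠ i → W l = 0) :
    latticePoint W ∈ vertices (face A u) := by
  obtain ⟨j, k, hij, hik, hjk⟩ := exists_others i
  refine mem_extremePoints_convexHull (EuclideanSpace.proj (𝕜 := ℝ) j + EuclideanSpace.proj k)
    ⟨W, hW, rfl⟩ ?_
  rintro _ ⟨ν, hν, rfl⟩ hne
  have hWj := hax j hij.symm
  have hWk := hax k hik.symm
  have hpos : 0 < ν j + ν k := by
    by_contra h
    have h1 : ν j = 0 := by omega
    have h2 : ν k = 0 := by omega
    have h3 := weight_eq_of_mem_minSet hν hW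
    rw [weight_distinct hij hik hjk, weight_distinct hij hik hjk, h1, h2, hWj, hWk] at h3
    have h4 : (ν i : ℝ) = W i := mul_left_cancel₀ (hu i).ne' (by linarith)
    refine hne (congrArg _ (ext_distinct hij hik hjk (by exact_mod_cast h4) ?_ ?_))
    · rw [h1, hWj]
    · rw [h2, hWk]
  have : (0 : ℝ) < ν j + ν k := by exact_mod_cast hpos
  simpa [latticePoint_apply, hWj, hWk] using this

/-- The weight `s` exposes the segment on all of `A`, hence on any face containing both ends. -/
theorem IsBridge.isExposed {j k : Fin 3} {P Q : Fin 3 → ℕ} {s : Fin 3 → ℝ}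
    (hb : IsBridge A j k P Q s) {u : Fin 3 → ℝ} (hP : P ∈ minSet A u) (hQ : Q ∈ minSet A u) :
    IsExposed ℝ (face A u) (segment ℝ (latticePoint P) (latticePoint Q)) := by
  have hℓ : ∀ ν, innerSL ℝ (WithLp.toLp 2 s : EuclideanSpace ℝ (Fin 3)) (latticePoint ν) =
      weight s ν := fun ν => by
    rw [innerSL_apply_apply, inner_latticePoint]
  have := isExposed_convexHull (innerSL ℝ (WithLp.toLp 2 s : EuclideanSpace ℝ (Fin 3)))
    (s := latticePoint '' minSet A u) (c := weight s P) ?_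
  · refine (congrArg (IsExposed ℝ (face A u)) (Subset.antisymm ?_ ?_)).mpr this
    · refine segment_subset_convexHull ⟨⟨P, hP, rfl⟩, hℓ P⟩ ⟨⟨Q, hQ, rfl⟩, ?_⟩
      rw [hℓ, weight_eq_of_mem_minSet hb.right_mem hb.left_mem]
    · refine convexHull_min ?_ (convex_segment _ _)
      rintro _ ⟨⟨ν, hν, rfl⟩, hνs⟩
      rw [hℓ] at hνs
      obtain ⟨r, hr⟩ := hb.onLine ν (mem_minSet_of_weight_le hb.left_mem hν.1 hνs.le)
      have hQj : (0 : ℝ) < Q j := by exact_mod_cast hb.right_pos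
      have hPk : (0 : ℝ) < P k := by exact_mod_cast hb.left_pos
      have h1 := hr j
      have h2 := hr k
      rw [hb.left_zero] at h1
      rw [hb.right_zero] at h2
      push_cast at h1 h2
      have hνj : (0 : ℝ) ≤ ν j := Nat.cast_nonneg _
      have hνk : (0 : ℝ) ≤ ν k := Nat.cast_nonneg _
      -- No lattice point lies on the line beyond the ends: `x_j` would turn negative past `P`, and
      -- `x_k` past `Q`.
      have hr0 : 0 ≤ r := by
        by_contra! h
        linarith [mul_neg_of_neg_of_pos h hQj]
      have hr1 : r ≤ 1 := by
        by_contra! h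
        linarith [mul_lt_mul_of_pos_right h hPk]
      refine ⟨1 - r, r, by linarith, hr0, by ring, ?_⟩
      ext l
      simp only [PiLp.add_apply, PiLp.smul_apply, latticePoint_apply, smul_eq_mul, hr l]
      ring
  · rintro _ ⟨ν, hν, rfl⟩
    rw [hℓ]
    exact hb.left_mem.2 ν hν.1

theorem IsBridge.left_mem_vertices {j k : Fin 3} {P Q : Fin 3 → ℕ} {s : Fin 3 → ℝ}
    (hb : IsBridge A j k P Q s) {u : Fin 3 → ℝ} (hP : P ∈ minSet A u) (hQ : Q ∈ minSet A u) :
    latticePoint P ∈ vertices (face A u) := by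
  refine isExtreme_singleton.mp ((hb.isExposed hP hQ).isExtreme.trans (isExtreme_singleton.mpr ?_))
  rw [← convexHull_pair]
  refine mem_extremePoints_convexHull (EuclideanSpace.proj (𝕜 := ℝ) j) (by simp) ?_
  rintro x (rfl | rfl) hne
  · exact absurd rfl hne
  · simp [latticePoint_apply, hb.left_zero, hb.right_pos]

theorem IsBridge.isEdge {j k : Fin 3} {P Q : Fin 3 → ℕ} {s : Fin 3 → ℝ}
    (hb : IsBridge A j k P Q s) {u : Fin 3 → ℝ} (hP : P ∈ minSet A u) (hQ : Q ∈ minSet A u) :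
    IsEdge (face A u) (latticePoint P) (latticePoint Q) := by
  refine ⟨fun h => ?_, hb.isExposed hP hQ⟩
  have h1 := latticePoint_injective h
  have h2 := hb.right_pos
  rw [← h1, hb.left_zero] at h2
  exact absurd h2 (lt_irrefl 0)

theorem bridge_conclusion {i j k : Fin 3} (hij : i ≠ j) (hik : i ≠ k) (hjk : j ≠ k)
    {P Q : Fin 3 → ℕ} {s : Fin 3 → ℝ} (hb : IsBridge A j k P Q s) {u : Fin 3 → ℝ}
    (hP : P ∈ minSet A u) (hQ : Q ∈ minSet A u) (hPk : P k = 1) :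
    ∃ j k : Fin 3, j ≠ i ∧ k ≠ i ∧ j ≠ k ∧
      ∃ W ∈ vertices (face A u), ∃ Y ∈ vertices (face A u),
        W ∈ coordPlane i j ∧ Metric.infDist W (axis i) = 1 ∧ Y ∈ coordPlane i k ∧
        IsEdge (face A u) W Y := by
  refine ⟨k, j, hik.symm, hij.symm, hjk.symm, latticePoint P, hb.left_mem_vertices hP hQ,
    latticePoint Q, hb.symm.left_mem_vertices hQ hP, ?_, ?_, ?_, hb.isEdge hP hQ⟩
  · refine forall_distinct hij hik hjk (fun h => absurd rfl h) (fun _ _ => ?_)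
      (fun _ h => absurd rfl h)
    rw [latticePoint_apply, hb.left_zero, Nat.cast_zero]
  · exact (infDist_latticePoint_axis hij hik hjk P).mpr (Or.inr ⟨hb.left_zero, hPk⟩)
  · refine forall_distinct hij hik hjk (fun h => absurd rfl h) (fun _ h => absurd rfl h)
      (fun _ _ => ?_)
    rw [latticePoint_apply, hb.right_zero, Nat.cast_zero]

end Space

/-! ### Taylor coefficients and zeros of holomorphic functions -/

section Derivatives

variable {n : ℕ} {f g : (Fin n → ℂ) → ℂ} {B : Set (Fin n → ℂ)}

theorem analyticOnNhd_partialDeriv (hf : AnalyticOnNhd ℂ f B) (i : Fin n) :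
    AnalyticOnNhd ℂ (partialDeriv i f) B := fun z hz =>
  (ContinuousLinearMap.apply ℂ ℂ (Pi.single i 1 : Fin n → ℂ)).analyticAt _ |>.comp (hf.fderiv z hz)

theorem analyticOnNhd_iterate_partialDeriv (hf : AnalyticOnNhd ℂ f B) (i : Fin n) (a : ℕ) :
    AnalyticOnNhd ℂ ((partialDeriv i)^[a] f) B := by
  induction a with
  | zero => exact hf
  | succ a ih => rw [Function.iterate_succ_apply']; exact analyticOnNhd_partialDeriv ih i

theorem eqOn_partialDeriv (hB : IsOpen B) (h : EqOn f g B) (i : Fin n) :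
    EqOn (partialDeriv i f) (partialDeriv i g) B := fun z hz => by
  rw [partialDeriv, partialDeriv, Filter.EventuallyEq.fderiv_eq (h.eventuallyEq_of_mem
    (hB.mem_nhds hz))]

theorem eqOn_iterate_partialDeriv (hB : IsOpen B) (h : EqOn f g B) (i : Fin n) (a : ℕ) :
    EqOn ((partialDeriv i)^[a] f) ((partialDeriv i)^[a] g) B := by
  induction a with
  | zero => exact h
  | succ a ih =>
    rw [Function.iterate_succ_apply', Function.iterate_succ_apply']
    exact eqOn_partialDeriv hB ih i

theorem partialDeriv_comm (hf : AnalyticOnNhd ℂ f B) (i j : Fin n) :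
    EqOn (partialDeriv i (partialDeriv j f)) (partialDeriv j (partialDeriv i f)) B := by
  intro z hz
  have hsymm : IsSymmSndFDerivAt ℂ f z :=
    (hf z hz).contDiffAt.isSymmSndFDerivAt (n := ⊤) le_top
  have key : ∀ a b : Fin n, partialDeriv a (partialDeriv b f) z =
      fderiv ℂ (fderiv ℂ f) z (Pi.single a 1) (Pi.single b 1) := fun a b => by
    have hd : DifferentiableAt ℂ (fderiv ℂ f) z := (hf.fderiv z hz).differentiableAt
    have : partialDeriv b f = fun w => fderiv ℂ f w (Pi.single b 1) := rfl
    rw [partialDeriv, this, fderiv_clm_apply hd (differentiableAt_const _)]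
    simp
  rw [key, key, hsymm.eq]

theorem iterate_partialDeriv_comm (hB : IsOpen B) (hf : AnalyticOnNhd ℂ f B) (i j : Fin n)
    (a b : ℕ) : EqOn ((partialDeriv i)^[a] ((partialDeriv j)^[b] f))
      ((partialDeriv j)^[b] ((partialDeriv i)^[a] f)) B := by
  have one : ∀ b, ∀ {g : (Fin n → ℂ) → ℂ}, AnalyticOnNhd ℂ g B →
      EqOn (partialDeriv i ((partialDeriv j)^[b] g)) ((partialDeriv j)^[b] (partialDeriv i g)) B := by
    intro b
    induction b with
    | zero => exact fun _ => eqOn_refl _ _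
    | succ b ih =>
      intro g hg
      rw [Function.iterate_succ_apply, Function.iterate_succ_apply]
      exact (ih (analyticOnNhd_partialDeriv hg j)).trans
        (eqOn_iterate_partialDeriv hB (partialDeriv_comm hg i j) j b)
  induction a with
  | zero => exact eqOn_refl _ _
  | succ a ih =>
    rw [Function.iterate_succ_apply', Function.iterate_succ_apply']
    exact (eqOn_partialDeriv hB ih i).trans (one b (analyticOnNhd_iterate_partialDeriv hf i a))

/-- In three variables, the mixed partial derivative can be computed in any order. -/
theorem mixedPartialDeriv_eqOn {f : (Fin 3 → ℂ) → ℂ} {B : Set (Fin 3 → ℂ)} (hB : IsOpen B)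
    (hf : AnalyticOnNhd ℂ f B) {i j k : Fin 3} (hij : i ≠ j) (hik : i ≠ k) (hjk : j ≠ k)
    (ν : Fin 3 → ℕ) : EqOn (mixedPartialDeriv ν f)
      ((partialDeriv i)^[ν i] ((partialDeriv j)^[ν j] ((partialDeriv k)^[ν k] f))) B := by
  have h0 : mixedPartialDeriv ν f =
      (partialDeriv 0)^[ν 0] ((partialDeriv 1)^[ν 1] ((partialDeriv 2)^[ν 2] f)) := rfl
  rw [h0]
  have swap₁ : ∀ a b c : Fin 3, EqOn
      ((partialDeriv a)^[ν a] ((partialDeriv b)^[ν b] ((partialDeriv c)^[ν c] f)))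
      ((partialDeriv b)^[ν b] ((partialDeriv a)^[ν a] ((partialDeriv c)^[ν c] f))) B := fun a b c =>
    iterate_partialDeriv_comm hB (analyticOnNhd_iterate_partialDeriv hf c _) a b _ _
  have swap₂ : ∀ a b c : Fin 3, EqOn
      ((partialDeriv a)^[ν a] ((partialDeriv b)^[ν b] ((partialDeriv c)^[ν c] f)))
      ((partialDeriv a)^[ν a] ((partialDeriv c)^[ν c] ((partialDeriv b)^[ν b] f))) B := fun a b c =>
    eqOn_iterate_partialDeriv hB (iterate_partialDeriv_comm hB hf b c _ _) a _
  fin_cases i <;> fin_cases j <;> fin_cases k <;>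
    first
    | exact absurd rfl hij
    | exact absurd rfl hik
    | exact absurd rfl hjk
    | exact eqOn_refl _ _
    | exact swap₁ 0 1 2
    | exact swap₂ 0 1 2
    | exact (swap₁ 0 1 2).trans (swap₂ 1 0 2)
    | exact (swap₂ 0 1 2).trans (swap₁ 0 2 1)
    | exact ((swap₁ 0 1 2).trans (swap₂ 1 0 2)).trans (swap₁ 1 2 0)

theorem taylorCoeff_eq_zero_iff {ν : Fin n → ℕ} :
    taylorCoeff f ν = 0 ↔ mixedPartialDeriv ν f 0 = 0 := by
  rw [taylorCoeff, div_eq_zero_iff, or_iff_left]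
  exact_mod_cast Finset.prod_ne_zero_iff.mpr fun i _ => Nat.factorial_ne_zero _

theorem hasDerivAt_line {z : Fin n → ℂ} {i : Fin n} {s : ℂ}
    (hf : AnalyticAt ℂ f (z + s • Pi.single i 1)) :
    HasDerivAt (fun t : ℂ => f (z + t • Pi.single i 1))
      (partialDeriv i f (z + s • Pi.single i 1)) s := by
  have h1 : HasDerivAt (fun t : ℂ => z + t • (Pi.single i 1 : Fin n → ℂ)) (Pi.single i 1) s := by
    simpa using ((hasDerivAt_id s).smul_const (Pi.single i 1 : Fin n → ℂ)).const_add z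
  exact hf.differentiableAt.hasFDerivAt.comp_hasDerivAt s h1

theorem line_mem_ball {z : Fin n → ℂ} {i : Fin n} {r : ℝ} (hr : 0 < r)
    (hz : z ∈ Metric.ball (0 : Fin n → ℂ) r) (hzi : z i = 0) {s : ℂ} (hs : s ∈ Metric.ball (0 : ℂ) r) :
    z + s • Pi.single i 1 ∈ Metric.ball (0 : Fin n → ℂ) r := by
  rw [mem_ball_zero_iff] at hz hs ⊢
  rw [pi_norm_lt_iff hr] at hz ⊢
  intro l
  by_cases h : l = i
  · subst h; simpa [hzi] using hs
  · simpa [Pi.single_eq_of_ne h] using hz l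

/-- A function whose partial derivatives of all orders in one direction vanish at a point vanishes
along that direction. -/
theorem eq_zero_on_line {r : ℝ} (hr : 0 < r) (hf : AnalyticOnNhd ℂ f (Metric.ball 0 r))
    {z : Fin n → ℂ} (hz : z ∈ Metric.ball (0 : Fin n → ℂ) r) {i : Fin n} (hzi : z i = 0)
    (h : ∀ a : ℕ, (partialDeriv i)^[a] f z = 0) {s : ℂ} (hs : s ∈ Metric.ball (0 : ℂ) r) :
    f (z + s • Pi.single i 1) = 0 := by
  have hder : ∀ a : ℕ, EqOn (iteratedDeriv a fun t : ℂ => f (z + t • Pi.single i 1))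
      (fun t => (partialDeriv i)^[a] f (z + t • Pi.single i 1)) (Metric.ball (0 : ℂ) r) := by
    intro a
    induction a with
    | zero => intro t _; simp
    | succ a ih =>
      intro t ht
      rw [iteratedDeriv_succ,
        Filter.EventuallyEq.deriv_eq (ih.eventuallyEq_of_mem (Metric.isOpen_ball.mem_nhds ht)),
        Function.iterate_succ_apply']
      exact (hasDerivAt_line (analyticOnNhd_iterate_partialDeriv hf i a _
        (line_mem_ball hr hz hzi ht))).deriv
  have hdiff : DifferentiableOn ℂ (fun t : ℂ => f (z + t • Pi.single i 1)) (Metric.ball 0 r) :=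
    fun t ht => (hasDerivAt_line (hf _
      (line_mem_ball hr hz hzi ht))).differentiableAt.differentiableWithinAt
  have := Complex.taylorSeries_eq_on_ball hdiff hs
  rw [← this]
  refine (tsum_congr fun a => ?_).trans tsum_zero
  rw [hder a (Metric.mem_ball_self hr)]
  simp [h a]

/-- Zeros of a holomorphic function on a plane are not isolated. -/
theorem exists_zero_on_plane {r : ℝ} (hr : 0 < r) (hf : AnalyticOnNhd ℂ f (Metric.ball 0 r))
    (hf0 : f 0 = 0) {j k : Fin n} (hjk : j ≠ k) :
    ∃ s t : ℂ, s ∈ Metric.ball (0 : ℂ) r ∧ t ∈ Metric.ball (0 : ℂ) r ∧ (s ≠ 0 ∨ t ≠ 0) ∧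
      f (s • Pi.single j 1 + t • Pi.single k 1) = 0 := by
  by_contra! hne
  set γ : ℂ → ℂ → Fin n → ℂ := fun s t => s • Pi.single j 1 + t • Pi.single k 1 with hγ
  set ρ := r / 2 with hρ
  have hρ0 : 0 < ρ := half_pos hr
  have hρr : ρ < r := half_lt_self hr
  have hγn : ∀ {s t : ℂ}, ‖s‖ ≤ ρ → ‖t‖ ≤ ρ → γ s t ∈ Metric.closedBall (0 : Fin n → ℂ) ρ := by
    intro s t hs ht
    rw [mem_closedBall_zero_iff, pi_norm_le_iff_of_nonneg hρ0.le]
    intro l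
    by_cases h1 : l = j
    · subst h1; simpa [hγ, Pi.single_eq_of_ne hjk] using hs
    · by_cases h2 : l = k
      · subst h2; simpa [hγ, Pi.single_eq_of_ne h1] using ht
      · simpa [hγ, Pi.single_eq_of_ne h1, Pi.single_eq_of_ne h2] using hρ0.le
  have hsub : Metric.closedBall (0 : Fin n → ℂ) ρ ⊆ Metric.ball 0 r :=
    Metric.closedBall_subset_ball hρr
  have hbr : ∀ {s : ℂ}, ‖s‖ ≤ ρ → s ∈ Metric.ball (0 : ℂ) r := fun h => by
    rw [mem_ball_zero_iff]; linarith
  have hcont : ContinuousOn f (Metric.closedBall 0 ρ) := hf.continuousOn.mono hsub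
  have huc := (isCompact_closedBall (0 : Fin n → ℂ) ρ).uniformContinuousOn_of_continuous hcont
  have hγc : ∀ s, Continuous (γ s) := fun s => by fun_prop
  -- If the origin were the only zero, the modulus would be at least `m > 0` on a circle in the disc
  -- `s = 0`. On the nearby disc `s = σ` the function has no zero, so the maximum principle for its
  -- inverse gives modulus at least `3 * m / 4` at the centre, while continuity from `f 0 = 0` gives
  -- less than `m / 4`.
  obtain ⟨t₀, ht₀, hmin⟩ := (isCompact_sphere (0 : ℂ) ρ).exists_isMinOn
    (NormedSpace.sphere_nonempty.mpr hρ0.le) (f := fun t => ‖f (γ 0 t)‖) (by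
      refine (hcont.comp (hγc 0).continuousOn fun t ht => hγn (by simpa using hρ0.le) ?_).norm
      exact (mem_sphere_zero_iff_norm.mp ht).le)
  set m := ‖f (γ 0 t₀)‖ with hm
  have hm0 : 0 < m := by
    rw [hm, norm_pos_iff]
    have h1 := mem_sphere_zero_iff_norm.mp ht₀
    refine hne 0 t₀ (Metric.mem_ball_self hr) (hbr h1.le) (Or.inr ?_)
    rw [← norm_pos_iff, h1]; exact hρ0
  obtain ⟨δ, hδ, hclose⟩ := Metric.uniformContinuousOn_iff.mp huc (m / 4) (by positivity)
  set σ : ℝ := min δ ρ / 2 with hσ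
  have hσ0 : 0 < σ := half_pos (lt_min hδ hρ0)
  have hσδ : σ < δ := (half_lt_self (lt_min hδ hρ0)).trans_le (min_le_left _ _)
  have hσρ : σ < ρ := (half_lt_self (lt_min hδ hρ0)).trans_le (min_le_right _ _)
  have hσn : ‖(σ : ℂ)‖ = σ := by rw [Complex.norm_real, Real.norm_eq_abs, abs_of_pos hσ0]
  have hdist : ∀ t, ‖t‖ ≤ ρ → ‖f (γ σ t) - f (γ 0 t)‖ < m / 4 := by
    intro t ht
    rw [← dist_eq_norm]
    refine hclose _ (hγn (by rw [hσn]; exact hσρ.le) ht) _ (hγn (by simpa using hρ0.le) ht) ?_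
    have : γ σ t - γ 0 t = (σ : ℂ) • Pi.single j 1 := by simp [hγ]
    rw [dist_eq_norm, this, norm_smul, hσn, Pi.norm_single, norm_one, mul_one]
    exact hσδ
  have hσne : (σ : ℂ) ≠ 0 := by exact_mod_cast hσ0.ne'
  have hnz : ∀ t, ‖t‖ ≤ ρ → f (γ σ t) ≠ 0 := fun t ht =>
    hne σ t (hbr (by rw [hσn]; exact hσρ.le)) (hbr ht) (Or.inl hσne)
  have hdiff : DifferentiableOn ℂ (fun t => (f (γ σ t))⁻¹) (Metric.closedBall 0 ρ) := by
    intro t ht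
    rw [mem_closedBall_zero_iff] at ht
    have h1 : DifferentiableAt ℂ (fun t => f (γ σ t)) t :=
      (hasDerivAt_line (z := (σ : ℂ) • Pi.single j 1)
        (hf _ (hsub (hγn (by rw [hσn]; exact hσρ.le) ht)))).differentiableAt
    exact (h1.inv (hnz t ht)).differentiableWithinAt
  have hmax := Complex.norm_le_of_forall_mem_frontier_norm_le (U := Metric.ball (0 : ℂ) ρ)
    (f := fun t => (f (γ σ t))⁻¹) (C := (3 * m / 4)⁻¹) Metric.isBounded_ball
    (DifferentiableOn.diffContOnCl (by rwa [closure_ball _ hρ0.ne'])) (by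
      intro t ht
      rw [frontier_ball _ hρ0.ne'] at ht
      have h1 := mem_sphere_zero_iff_norm.mp ht
      have h2 : m ≤ ‖f (γ 0 t)‖ := hmin ht
      have h3 := hdist t h1.le
      have h4 := norm_sub_norm_le (f (γ 0 t)) (f (γ σ t))
      rw [norm_sub_rev] at h4
      rw [norm_inv]
      exact inv_anti₀ (by positivity) (by linarith))
    (subset_closure (Metric.mem_ball_self hρ0))
  have h0 : f (γ 0 0) = 0 := by simpa [hγ] using hf0
  have h1 := hdist 0 (by simpa using hρ0.le)
  rw [h0, sub_zero] at h1
  rw [norm_inv, inv_le_inv₀ (norm_pos_iff.mpr (hnz 0 (by simpa using hρ0.le)))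
    (by positivity)] at hmax
  linarith

end Derivatives

/-! ### The support of an isolated singularity -/

section Support

variable {f : (Fin 3 → ℂ) → ℂ}

theorem exists_radius (hf : IsIsolatedSingularity f) : ∃ r : ℝ, 0 < r ∧
    AnalyticOnNhd ℂ f (Metric.ball 0 r) ∧
    ∀ z ∈ Metric.ball (0 : Fin 3 → ℂ) r, z ≠ 0 → ∃ i, partialDeriv i f z ≠ 0 := by
  have h1 := hf.analyticAt.eventually_analyticAt
  have h2 := eventually_nhdsWithin_iff.mp hf.isolated
  obtain ⟨r, hr, h⟩ := Metric.eventually_nhds_iff_ball.mp (h1.and h2)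
  exact ⟨r, hr, fun z hz => (h z hz).1, fun z hz hne => (h z hz).2 hne⟩

theorem isolatedSupport (hf : IsIsolatedSingularity f) :
    IsolatedSupport {ν | taylorCoeff f ν ≠ 0} := by
  obtain ⟨r, hr, han, hiso⟩ := exists_radius hf
  have h0 : (0 : Fin 3 → ℂ) ∈ Metric.ball (0 : Fin 3 → ℂ) r := Metric.mem_ball_self hr
  have hmix : ∀ {i j k : Fin 3}, i ≠ j → i ≠ k → j ≠ k → ∀ ν : Fin 3 → ℕ,
      taylorCoeff f ν = 0 ↔
        (partialDeriv i)^[ν i] ((partialDeriv j)^[ν j] ((partialDeriv k)^[ν k] f)) 0 = 0 :=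
    fun hij hik hjk ν => by
      rw [taylorCoeff_eq_zero_iff, mixedPartialDeriv_eqOn Metric.isOpen_ball han hij hik hjk ν h0]
  have hexp : ∀ {i j k : Fin 3}, i ≠ j → i ≠ k → j ≠ k → ∀ a b c : ℕ,
      ∃ ν : Fin 3 → ℕ, ν i = a ∧ ν j = b ∧ ν k = c := fun {i j k} hij hik hjk a b c =>
    ⟨fun l => if l = i then a else if l = j then b else c, by simp, by simp [hij.symm],
      by simp [hik.symm, hjk.symm]⟩
  refine ⟨fun ν hν => ?_, fun i j k hij hik hjk => ?_, fun i => ?_⟩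
  · by_contra! hlt
    have hcase : (∀ l, ν l = 0) ∨ ∃ i j k : Fin 3, i ≠ j ∧ i ≠ k ∧ j ≠ k ∧ ν i = 1 ∧ ν j = 0 ∧
        ν k = 0 := by
      rw [Fin.sum_univ_three] at hlt
      have : (ν 0 = 0 ∧ ν 1 = 0 ∧ ν 2 = 0) ∨ (ν 0 = 1 ∧ ν 1 = 0 ∧ ν 2 = 0) ∨
        (ν 1 = 1 ∧ ν 0 = 0 ∧ ν 2 = 0) ∨ (ν 2 = 1 ∧ ν 0 = 0 ∧ ν 1 = 0) := by omega
      rcases this with h | h | h | h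
      · exact Or.inl (Fin.forall_fin_succ.mpr ⟨h.1, Fin.forall_fin_two.mpr h.2⟩)
      · exact Or.inr ⟨0, 1, 2, by decide, by decide, by decide, h⟩
      · exact Or.inr ⟨1, 0, 2, by decide, by decide, by decide, h⟩
      · exact Or.inr ⟨2, 0, 1, by decide, by decide, by decide, h⟩
    rcases hcase with h | ⟨i, j, k, hij, hik, hjk, h1, h2, h3⟩
    · refine hν ((hmix (i := 0) (j := 1) (k := 2) (by decide) (by decide) (by decide) ν).mpr ?_)
      rw [h, h, h]
      exact hf.map_zero
    · refine hν ((hmix hij hik hjk ν).mpr ?_)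
      rw [h1, h2, h3]
      exact hf.gradient_zero i
  · by_contra! hno
    -- Without monomials within distance one of the axis, all first partials vanish identically
    -- along it.
    have hline : ∀ l, ∀ a : ℕ, (partialDeriv i)^[a] (partialDeriv l f) 0 = 0 := by
      refine forall_distinct hij hik hjk (fun a => ?_) (fun a => ?_) (fun a => ?_)
      · obtain ⟨ν, h1, h2, h3⟩ := hexp hij hik hjk (a + 1) 0 0
        have := (hmix hij hik hjk ν).mp (by by_contra h; have := hno ν h; omega)
        rwa [h1, h2, h3] at this
      · obtain ⟨ν, h1, h2, h3⟩ := hexp hij hik hjk a 1 0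
        have := (hmix hij hik hjk ν).mp (by by_contra h; have := hno ν h; omega)
        rwa [h1, h2, h3] at this
      · obtain ⟨ν, h1, h2, h3⟩ := hexp hij hik hjk a 0 1
        have := (hmix hij hik hjk ν).mp (by by_contra h; have := hno ν h; omega)
        rwa [h1, h2, h3] at this
    have hs : ((r / 2 : ℝ) : ℂ) ∈ Metric.ball (0 : ℂ) r := by
      rw [mem_ball_zero_iff, Complex.norm_real, Real.norm_eq_abs, abs_of_pos (half_pos hr)]
      exact half_lt_self hr
    obtain ⟨l, hl⟩ := hiso _ (line_mem_ball (i := i) hr h0 rfl hs) fun h => by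
      have := congrFun h i
      simp [hr.ne'] at this
    exact hl (eq_zero_on_line hr (analyticOnNhd_partialDeriv han l) h0 rfl (hline l) hs)
  · by_contra! hno
    obtain ⟨j, k, hij, hik, hjk⟩ := exists_others i
    have hmixed : ∀ a b : ℕ, (partialDeriv j)^[a] ((partialDeriv k)^[b] f) 0 = 0 := fun a b => by
      obtain ⟨ν, h1, h2, h3⟩ := hexp hij hik hjk 0 a b
      have := (hmix hij hik hjk ν).mp (by by_contra h; exact hno ν h h1)
      rwa [h1, h2, h3] at this
    have hj : ∀ {s : ℂ}, s ∈ Metric.ball (0 : ℂ) r →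
        s • (Pi.single j 1 : Fin 3 → ℂ) ∈ Metric.ball (0 : Fin 3 → ℂ) r := fun hs => by
      simpa using line_mem_ball (i := j) hr h0 rfl hs
    have hjk0 : ∀ s : ℂ, (s • (Pi.single j 1 : Fin 3 → ℂ)) k = 0 := fun s => by
      simp [Pi.single_eq_of_ne hjk.symm]
    -- Without monomials in `x_i = 0`, `f` vanishes on that plane, and so do its two tangential
    -- partials. The normal partial vanishes at the origin, hence at another point of the plane,
    -- which is then a second critical point; the radius is arbitrary beyond `exists_radius`.
    have hplane : ∀ s ∈ Metric.ball (0 : ℂ) r, ∀ t ∈ Metric.ball (0 : ℂ) r,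
        f (s • Pi.single j 1 + t • Pi.single k 1) = 0 := fun s hs t ht =>
      eq_zero_on_line hr han (hj hs) (hjk0 s) (fun b => by
        simpa using eq_zero_on_line hr (analyticOnNhd_iterate_partialDeriv han k b) h0 (i := j) rfl
          (fun a => hmixed a b) hs) ht
    obtain ⟨s, t, hs, ht, hst, hzero⟩ := exists_zero_on_plane hr (analyticOnNhd_partialDeriv han i)
      (hf.gradient_zero i) hjk
    have hmem := line_mem_ball hr (hj hs) (hjk0 s) ht
    obtain ⟨l, hl⟩ := hiso _ hmem fun h => by
      have h1 := congrFun h j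
      have h2 := congrFun h k
      simp [Pi.single_eq_of_ne hjk, Pi.single_eq_of_ne hjk.symm] at h1 h2
      rcases hst with h | h <;> contradiction
    refine hl (forall_distinct hij hik hjk
      (p := fun l => partialDeriv l f (s • Pi.single j 1 + t • Pi.single k 1) = 0) hzero ?_ ?_ l)
    · have hcomm : ∀ s : ℂ, t • (Pi.single k 1 : Fin 3 → ℂ) + s • Pi.single j 1 =
          s • Pi.single j 1 + t • Pi.single k 1 := fun s => add_comm _ _
      have hd := hasDerivAt_line (f := f) (z := t • Pi.single k 1) (i := j) (s := s)
        (by rw [hcomm]; exact han _ hmem)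
      rw [hcomm] at hd
      refine hd.unique ((hasDerivAt_const s (0 : ℂ)).congr_of_eventuallyEq ?_)
      filter_upwards [Metric.isOpen_ball.mem_nhds hs] with s' hs'
      rw [hcomm]
      exact hplane s' hs' t ht
    · have hd := hasDerivAt_line (f := f) (z := s • Pi.single j 1) (i := k) (s := t) (han _ hmem)
      refine hd.unique ((hasDerivAt_const t (0 : ℂ)).congr_of_eventuallyEq ?_)
      filter_upwards [Metric.isOpen_ball.mem_nhds ht] with t' ht'
      exact hplane s hs t' ht'

theorem mem_newtonFaces_two (hA : {ν | taylorCoeff f ν ≠ 0}.Nonempty)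
    {S : Set (EuclideanSpace ℝ (Fin 3))} : S ∈ newtonFaces f 2 ↔ ∃ u : Fin 3 → ℝ, (∀ l, 0 < u l) ∧
      Full {ν | taylorCoeff f ν ≠ 0} u ∧ S = face {ν | taylorCoeff f ν ≠ 0} u := by
  have hpoly : newtonDiagram f = polyhedron {ν | taylorCoeff f ν ≠ 0} := rfl
  constructor
  · rintro ⟨⟨⟨u, hu, -, rfl⟩, hc⟩, hdim⟩
    rw [hpoly] at hc hdim ⊢
    have hne : (supportSet u (polyhedron {ν | taylorCoeff f ν ≠ 0})).Nonempty := by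
      by_contra h
      rw [not_nonempty_iff_eq_empty] at h
      rw [h, dim, vectorSpan_empty, finrank_bot] at hdim
      omega
    have hpos := pos_of_isCompact_supportSet hu hne hc
    rw [supportSet_eq_face hA hpos] at hdim ⊢
    exact ⟨u, hpos, (dim_face hpos).mp hdim, rfl⟩
  · rintro ⟨u, hpos, hfull, rfl⟩
    have heq := supportSet_eq_face hA (u := WithLp.toLp 2 u) hpos
    refine ⟨⟨⟨WithLp.toLp 2 u, fun l => (hpos l).le, fun h => ?_, ?_⟩, isCompact_face hpos⟩,
      (dim_face hpos).mpr hfull⟩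
    · exact (hpos 0).ne' (congrArg (fun x : EuclideanSpace ℝ (Fin 3) => x 0) h)
    · rw [hpoly, heq]

end Support

end NewtonDiagram

end

theorem lemma3 (f : (Fin 3 → ℂ) → ℂ) (hf : NewtonDiagram.IsIsolatedSingularity f)
    (hne : (NewtonDiagram.newtonFaces f 2 \ NewtonDiagram.exceptionalFaces f).Nonempty) :
    ∀ i : Fin 3, ∃ S ∈ NewtonDiagram.newtonFaces f 2 \ NewtonDiagram.exceptionalFaces f,
      (∃ W ∈ NewtonDiagram.axis i, W ∈ NewtonDiagram.vertices S) ∨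
      (∃ j k : Fin 3, j ≠ i ∧ k ≠ i ∧ j ≠ k ∧
        ∃ W ∈ NewtonDiagram.vertices S, ∃ Y ∈ NewtonDiagram.vertices S,
          W ∈ NewtonDiagram.coordPlane i j ∧
          Metric.infDist W (NewtonDiagram.axis i) = 1 ∧
          Y ∈ NewtonDiagram.coordPlane i k ∧
          NewtonDiagram.IsEdge S W Y) := by
  open NewtonDiagram in
  intro i
  have hA := isolatedSupport hf
  have hAne : {ν | taylorCoeff f ν ≠ 0}.Nonempty := by
    obtain ⟨ν, hν, -⟩ := hA.meets_plane 0
    exact ⟨ν, hν⟩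
  obtain ⟨S₀, hS₀, hS₀e⟩ := hne
  obtain ⟨v, hv, hvfull, rfl⟩ := (mem_newtonFaces_two hAne).mp hS₀
  obtain ⟨u, hu, hfull, hexc, ht⟩ := exists_touches hA hv hvfull
    (fun h => hS₀e ⟨hS₀, isExceptionalWrt_of_exc hv hvfull h⟩) i
  refine ⟨face {ν | taylorCoeff f ν ≠ 0} u, ⟨(mem_newtonFaces_two hAne).mpr ⟨u, hu, hfull, rfl⟩,
    fun h => ?_⟩, ?_⟩
  · obtain ⟨l, hl⟩ := h.2
    exact hexc (exc_of_isExceptionalWrt hu hfull hl)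
  · rcases ht with ⟨W, hW, hax⟩ | ⟨j, k, P, Q, s, hji, hki, hjk, hb, hP, hQ⟩
    · refine Or.inl ⟨latticePoint W, fun l hl => ?_, mem_vertices_of_axis hu hW hax⟩
      rw [latticePoint_apply, hax l hl, Nat.cast_zero]
    · right
      -- Either end may be the one at distance one; the bridge is symmetric under swapping its ends.
      rcases hb.near with h | h
      · exact bridge_conclusion hji.symm hki.symm hjk hb hP hQ h
      · exact bridge_conclusion hki.symm hji.symm hjk.symm hb.symm hQ hP h
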